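/- A topological graph $E=(E^0,E^1,r,s)$ consists of locally compact Hausdorff spaces $E^0$ (vertices) and $E^1$ (edges), not assumed second countable, a continuous map $r:E^1\to E^0$ and a local homeomorphism $s:E^1\to E^0$. Let $E^0_{\mathrm{reg}}\subseteq E^0$ be the largest open set such that $r$ restricts to a proper surjection $r^{-1}(E^0_{\mathrm{reg}})\to E^0_{\mathrm{reg}}$, and put $E^0_{\mathrm{sng}}=E^0\setminus E^0_{\mathrm{reg}}$. For $n\ge 1$ let $E^n$ be the space of words $\alpha_1\cdots\alpha_n$ with $\alpha_i\in E^1$ and $s(\alpha_i)=r(\alpha_{i+1})$, with the topology inherited from the product; let $E^*=\coprod_{n\ge 0}E^n$, with $r(\alpha)=r(\alpha_1)$ and $s(\alpha)=s(\alpha_n)$ (and $r(v)=s(v)=v$ for $v\in E^0$), and let $E^\infty$ be the set of infinite words $\alpha_1\alpha_2\cdots$ with $s(\alpha_i)=r(\alpha_{i+1})$ for all $i$, with $r(\alpha)=r(\alpha_1)$. The boundary path space is $$\partial E=\{\alpha\in E^*: s(\alpha)\in E^0_{\mathrm{sng}}\}\cup E^\infty .$$ For $S\subseteq E^*$ let $Z(S)$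 be the set of $\alpha\in\partial E$ such that $r(\alpha)\in S$ or some initial segment $\alpha_1\cdots\alpha_k$ of $\alpha$ $(k\ge 1)$ is in $S$. The topology of $\partial E$ is the one generated by the sets $Z(U)\setminus Z(K)$ with $U\subseteq E^*$ open and $K\subseteq E^*$ compact. The backward shift $\sigma:\partial E\setminus E^0\to\partial E$ removes the first edge, with $\sigma(\alpha_1)=s(\alpha_1)$ for a path of length one. (With this topology $\partial E$ is locally compact Hausdorff and $\sigma$ is a local homeomorphism.) For a local homeomorphism $\varphi:X\to Y$ between locally compact Hausdorff spaces and a Radon measure $\mu$ on $Y$, let $\varphi^*\mu$ be the unique Radon measure on $X$ with $\int_X f\,d\varphi^*\mu=\int_Y\sum_{x\in\varphi^{-1}(y)}f(x)\,d\mu(y)$ for all $f\in C_c(X)$. An invariant measure on $E$ is a Radon probability measure $\mu$ on $E^0$ such that $\int_{E^1}f\circ r\,ds^*\mu\le\int_{E^0}f\,d\mu$ for all $f\ge 0$ in $C_c(E^0)$, with equality when $\operatorname{supp}(f)\subseteq E^0_{\mathrm{reg}}$. **Proposition.** Let $E$ be a topological graph and $\mu$ an invariant measure on $E$. There is a Radon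 probability measure $\tilde\mu$ on $\partial E$ such that $$\int_{\partial E}f\circ r\,d\tilde\mu=\int_{E^0}f\,d\mu\qquad\text{for each } f\in C_c(E^0),$$ $$\int_{\partial E\setminus E^0}f\,d\sigma^*\tilde\mu=\int_{\partial E}f\,d\tilde\mu\qquad\text{for each } f\in C_c(\partial E\setminus E^0),$$ where in the last integral $f$ is extended by zero to $\partial E$. -/

import Mathlib

open MeasureTheory Topology
open scoped CompactlySupported

/-! ### Pulling back Radon measures along local homeomorphisms -/

section Pullback

/-- The sum of `f` over the fibre of `φ` at `y`. -/
noncomputable def fiberSum {X Y F : Type*} [AddCommMonoid F] (φ : X → Y) (f : X → F) (y : Y) : F :=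
  ∑ᶠ x : φ ⁻¹' {y}, f x

/-- `ν` is a Radon measure on `X` such that
`∫ f dν = ∫ (∑_{x ∈ φ⁻¹(y)} f(x)) dμ(y)` for all `f ∈ C_c(X)`. -/
structure IsRadonPullback {X Y : Type*} [TopologicalSpace X] [MeasurableSpace X] [BorelSpace X]
    [TopologicalSpace Y] [MeasurableSpace Y] (φ : X → Y) (μ : Measure Y) (ν : Measure X) :
    Prop where
  regular : ν.Regular
  integral_eq : ∀ f : C_c(X, ℂ), ∫ x, f x ∂ν = ∫ y, fiberSum φ f y ∂μ

open scoped Classical in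
/-- The pullback `φ^*μ` of a Radon measure `μ` along a local homeomorphism `φ`. See
`isRadonPullback_radonPullback` and `IsRadonPullback.unique` for existence and uniqueness. -/
noncomputable def radonPullback {X Y : Type*} [TopologicalSpace X] [MeasurableSpace X]
    [BorelSpace X] [TopologicalSpace Y] [MeasurableSpace Y] (φ : X → Y) (μ : Measure Y) :
    Measure X :=
  if h : ∃ ν : Measure X, IsRadonPullback φ μ ν then h.choose else 0

theorem IsRadonPullback.unique {X Y : Type*} [TopologicalSpace X] [T2Space X]
    [LocallyCompactSpace X] [MeasurableSpace X] [BorelSpace X] [TopologicalSpace Y]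
    [MeasurableSpace Y] {φ : X → Y} {μ : Measure Y} {ν ν' : Measure X}
    (h : IsRadonPullback φ μ ν) (h' : IsRadonPullback φ μ ν') : ν = ν' := by
  have := h.regular
  have := h'.regular
  refine Measure.ext_of_integral_eq_on_compactlySupported fun f => ?_
  let g : C_c(X, ℂ) := ⟨⟨fun x => (f x : ℂ), by fun_prop⟩,
    f.hasCompactSupport.comp_left (g := fun t : ℝ => (t : ℂ)) (by simp)⟩
  have hg : ∫ x, ((f x : ℝ) : ℂ) ∂ν = ∫ x, ((f x : ℝ) : ℂ) ∂ν' :=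
    (h.integral_eq g).trans (h'.integral_eq g).symm
  rw [integral_complex_ofReal, integral_complex_ofReal] at hg
  exact_mod_cast hg

variable {X Y : Type*} [TopologicalSpace X] [TopologicalSpace Y]

private theorem exists_cover (φ : X → Y) (hφ : IsLocalHomeomorph φ) {K : Set X}
    (hK : IsCompact K) : ∃ (n : ℕ) (x : Fin n → X), K ⊆ ⋃ i, (hφ.localInverseAt (x i)).target := by
  obtain ⟨t, ht⟩ := hK.elim_finite_subcover (fun x : X => (hφ.localInverseAt x).target)
    (fun x => (hφ.localInverseAt x).open_target)
    (fun x _ => Set.mem_iUnion.2 ⟨x, hφ.self_mem_localInverseAt_target⟩)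
  refine ⟨t.card, fun i => (t.equivFin.symm i : X), fun x hx => ?_⟩
  obtain ⟨y, hy, hxy⟩ := Set.mem_iUnion₂.1 (ht hx)
  refine Set.mem_iUnion.2 ⟨t.equivFin ⟨y, hy⟩, ?_⟩
  simpa using hxy

private theorem inj_target (φ : X → Y) (hφ : IsLocalHomeomorph φ) (z : X) :
    (hφ.localInverseAt z).target.InjOn φ := hφ.injOn_localInverseAt_target

theorem fiber_support_finite {F : Type*} [AddCommMonoid F] {φ : X → Y}
    (hφ : IsLocalHomeomorph φ) {f : X → F} (hf : HasCompactSupport f) (y : Y) :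
    (Function.support fun x : φ ⁻¹' {y} => f x).Finite := by
  obtain ⟨n, x, hx⟩ := exists_cover φ hφ hf
  refine Set.Finite.subset (s := ⋃ i : Fin n,
    {z : φ ⁻¹' {y} | (z : X) ∈ (hφ.localInverseAt (x i)).target}) ?_ ?_
  · refine Set.finite_iUnion fun i => Set.Subsingleton.finite ?_
    rintro ⟨a, ha⟩ ha' ⟨b, hb⟩ hb'
    have : φ a = φ b := by rw [ha, hb]
    exact Subtype.ext (inj_target φ hφ (x i) ha' hb' this)
  · intro z hz
    obtain ⟨i, hi⟩ := Set.mem_iUnion.1 (hx (subset_tsupport f hz))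
    exact Set.mem_iUnion.2 ⟨i, hi⟩

theorem fiberSum_add {F : Type*} [AddCommMonoid F] {φ : X → Y}
    (hφ : IsLocalHomeomorph φ) {f g : X → F} (hf : HasCompactSupport f)
    (hg : HasCompactSupport g) : fiberSum φ (f + g) = fiberSum φ f + fiberSum φ g := by
  ext y
  exact finsum_add_distrib (fiber_support_finite hφ hf y) (fiber_support_finite hφ hg y)

theorem fiberSum_map {F G : Type*} [AddCommMonoid F] [AddCommMonoid G] {φ : X → Y}
    (hφ : IsLocalHomeomorph φ) {f : X → F} (hf : HasCompactSupport f) (T : F →+ G) (y : Y) :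
    fiberSum φ (fun x => T (f x)) y = T (fiberSum φ f y) :=
  (T.map_finsum (fiber_support_finite hφ hf y)).symm

private theorem fiberSum_chart [T2Space Y] {F : Type*} [AddCommMonoid F] [TopologicalSpace F]
    {φ : X → Y} (hφ : IsLocalHomeomorph φ) {f : X → F} (hc : Continuous f)
    (hf : HasCompactSupport f) (z : X) (hz : tsupport f ⊆ (hφ.localInverseAt z).target) :
    Continuous (fiberSum φ f) ∧ HasCompactSupport (fiberSum φ f) := by
  set e := hφ.localInverseAt z with he
  have hsymm : (e.symm : X → Y) = φ := hφ.localInverseAt_symm z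
  have hK : IsCompact (φ '' tsupport f) := IsCompact.image hf hφ.continuous
  have h0 : ∀ y, y ∉ φ '' tsupport f → fiberSum φ f y = 0 := by
    intro y hy
    refine finsum_eq_zero_of_forall_eq_zero ?_
    rintro ⟨x, hx⟩
    exact image_eq_zero_of_notMem_tsupport fun h => hy ⟨x, h, hx⟩
  have h1 : ∀ y ∈ e.source, fiberSum φ f y = f (e y) := by
    intro y hy
    have hey : φ (e y) = y := by rw [← hsymm]; exact e.left_inv hy
    refine finsum_eq_single (fun x : φ ⁻¹' {y} => f x) ⟨e y, hey⟩ ?_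
    rintro ⟨x, hx⟩ hne
    refine image_eq_zero_of_notMem_tsupport fun h => hne (Subtype.ext ?_)
    exact inj_target φ hφ z (hz h) (e.map_source hy) (by rw [hey]; exact hx)
  refine ⟨continuous_iff_continuousAt.2 fun y => ?_,
    HasCompactSupport.intro hK fun y hy => h0 y hy⟩
  by_cases hy : y ∈ φ '' tsupport f
  · obtain ⟨x, hx, rfl⟩ := hy
    have hs : φ x ∈ e.source := by rw [← hsymm]; exact e.map_target (hz hx)
    refine ContinuousAt.congr (f := fun y => f (e y)) ?_ ?_
    · exact hc.continuousAt.comp (e.continuousAt hs)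
    · filter_upwards [e.open_source.mem_nhds hs] with y hy using (h1 y hy).symm
  · refine ContinuousAt.congr (f := fun _ => (0 : F)) continuousAt_const ?_
    filter_upwards [hK.isClosed.isOpen_compl.mem_nhds hy] with y hy using (h0 y hy).symm

theorem fiberSum_continuous_hasCompactSupport [T2Space X] [LocallyCompactSpace X] [T2Space Y]
    {F : Type*} [AddCommGroup F] [Module ℝ F] [TopologicalSpace F] [IsTopologicalAddGroup F]
    [ContinuousSMul ℝ F]
    {φ : X → Y} (hφ : IsLocalHomeomorph φ) {f : X → F} (hc : Continuous f)
    (hf : HasCompactSupport f) :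
    Continuous (fiberSum φ f) ∧ HasCompactSupport (fiberSum φ f) := by
  obtain ⟨n, x, hx⟩ := exists_cover φ hφ hf
  obtain ⟨g, hg1, hg2, -, -⟩ := exists_continuous_sum_one_of_isOpen_isCompact
    (fun i => (hφ.localInverseAt (x i)).open_target) hf hx
  have hcs : ∀ i, HasCompactSupport (fun x => g i x • f x) := fun i =>
    hf.mono fun x hx h0 => hx (by simp [h0])
  have hi : ∀ i, Continuous (fiberSum φ fun x => g i x • f x) ∧
      HasCompactSupport (fiberSum φ fun x => g i x • f x) := fun i => by
    refine fiberSum_chart hφ (by fun_prop) (hcs i) (x i) (subset_trans ?_ (hg1 i))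
    exact closure_mono fun x hx h0 => hx (by simp [h0])
  have hsum : fiberSum φ f = fun y => ∑ i, fiberSum φ (fun x => g i x • f x) y := by
    ext y
    have : f = fun x => ∑ i, g i x • f x := by
      ext x
      by_cases h : x ∈ tsupport f
      · have := hg2 h
        simp only [Finset.sum_apply, Pi.one_apply] at this
        rw [← Finset.sum_smul, this, one_smul]
      · simp [image_eq_zero_of_notMem_tsupport h]
    conv_lhs => rw [this]
    exact finsum_sum_comm _ _ fun i _ => fiber_support_finite hφ (hcs i) y
  rw [hsum]
  refine ⟨continuous_finsetSum _ fun i _ => (hi i).1, ?_⟩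
  refine HasCompactSupport.intro (K := ⋃ i, tsupport (fiberSum φ fun x => g i x • f x))
    (isCompact_iUnion fun i => (hi i).2) fun y hy => ?_
  refine Finset.sum_eq_zero fun i _ => image_eq_zero_of_notMem_tsupport fun h => hy ?_
  exact Set.mem_iUnion.2 ⟨i, h⟩

/-- For a local homeomorphism between locally compact Hausdorff spaces, the pullback of a Radon
measure exists, so that `radonPullback` is characterised by its defining property. -/
theorem isRadonPullback_radonPullback [T2Space X] [LocallyCompactSpace X] [MeasurableSpace X]
    [BorelSpace X] [T2Space Y] [MeasurableSpace Y] [BorelSpace Y] {φ : X → Y}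
    (hφ : IsLocalHomeomorph φ) (μ : Measure Y) [IsFiniteMeasureOnCompacts μ] :
    IsRadonPullback φ μ (radonPullback φ μ) := by
  suffices h : ∃ ν : Measure X, IsRadonPullback φ μ ν by
    rw [radonPullback, dif_pos h]
    exact h.choose_spec
  have hR : ∀ f : C_c(X, ℝ), Continuous (fiberSum φ f) ∧ HasCompactSupport (fiberSum φ f) :=
    fun f => fiberSum_continuous_hasCompactSupport hφ f.continuous f.hasCompactSupport
  have hint : ∀ f : C_c(X, ℝ), Integrable (fiberSum φ f) μ := fun f =>
    (hR f).1.integrable_of_hasCompactSupport (hR f).2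
  let L : C_c(X, ℝ) →ₗ[ℝ] ℝ :=
    { toFun := fun f => ∫ y, fiberSum φ f y ∂μ
      map_add' := fun f g => by
        rw [← integral_add (hint f) (hint g)]
        have := fiberSum_add hφ f.hasCompactSupport g.hasCompactSupport
        exact integral_congr_ae (.of_forall fun y => congrFun this y)
      map_smul' := fun c f => by
        simp only [RingHom.id_apply, smul_eq_mul]
        rw [← integral_const_mul]
        refine integral_congr_ae (.of_forall fun y => ?_)
        exact fiberSum_map hφ f.hasCompactSupport (AddMonoidHom.mulLeft c) y }
  let P : C_c(X, ℝ) →ₚ[ℝ] ℝ := PositiveLinearMap.mk₀ L fun f hf => by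
    refine integral_nonneg fun y => finsum_nonneg fun x => hf x
  refine ⟨RealRMK.rieszMeasure P, inferInstance, fun f => ?_⟩
  have key : ∀ g : C_c(X, ℝ), ∫ x, g x ∂(RealRMK.rieszMeasure P) = ∫ y, fiberSum φ g y ∂μ :=
    fun g => RealRMK.integral_rieszMeasure P g
  have hfν : Integrable f (RealRMK.rieszMeasure P) :=
    f.continuous.integrable_of_hasCompactSupport f.hasCompactSupport
  have hC := fiberSum_continuous_hasCompactSupport hφ f.continuous f.hasCompactSupport
  have hfμ : Integrable (fiberSum φ f) μ := hC.1.integrable_of_hasCompactSupport hC.2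
  let fr : C_c(X, ℝ) := ⟨⟨fun x => (f x).re, by fun_prop⟩,
    f.hasCompactSupport.comp_left (g := Complex.re) (by simp)⟩
  let fi : C_c(X, ℝ) := ⟨⟨fun x => (f x).im, by fun_prop⟩,
    f.hasCompactSupport.comp_left (g := Complex.im) (by simp)⟩
  have e1 : ∀ y, fiberSum φ fr y = (fiberSum φ f y).re := fun y =>
    fiberSum_map hφ f.hasCompactSupport Complex.reAddGroupHom y
  have e2 : ∀ y, fiberSum φ fi y = (fiberSum φ f y).im := fun y =>
    fiberSum_map hφ f.hasCompactSupport Complex.imAddGroupHom y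
  have k1 := key fr
  have k2 := key fi
  simp only [e1, e2] at k1 k2
  apply Complex.ext
  · have a := integral_re hfν
    have b := integral_re hfμ
    simp only [RCLike.re_to_complex] at a b
    rw [← a, ← b]
    exact k1
  · have a := integral_im hfν
    have b := integral_im hfμ
    simp only [RCLike.im_to_complex] at a b
    rw [← a, ← b]
    exact k2

end Pullback

/-! ### Topological graphs -/

/-- A topological graph with vertex space `V` and edge space `D`. -/
structure TopologicalGraph (V D : Type*) [TopologicalSpace V] [T2Space V] [LocallyCompactSpace V]
    [TopologicalSpace D] [T2Space D] [LocallyCompactSpace D] where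
  /-- the range map -/
  r : D → V
  /-- the source map -/
  s : D → V
  continuous_r : Continuous r
  isLocalHomeomorph_s : IsLocalHomeomorph s

namespace TopologicalGraph

variable {V D : Type*} [TopologicalSpace V] [T2Space V] [LocallyCompactSpace V]
  [TopologicalSpace D] [T2Space D] [LocallyCompactSpace D] (E : TopologicalGraph V D)

/-- The set of regular vertices: the largest open set `U` such that `r` restricts to a proper
surjection `r⁻¹(U) → U`. -/
def regular : Set V :=
  ⋃₀ {U : Set V | IsOpen U ∧ IsProperMap (U.restrictPreimage E.r) ∧
    Function.Surjective (U.restrictPreimage E.r)}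

/-- The set of singular vertices. -/
def singular : Set V := E.regularᶜ

/-- Paths of length `n`, recorded with all the vertices they visit: `vertices v₀, …, vₙ` and edges
`e₀, …, eₙ₋₁` with `r eᵢ = vᵢ` and `s eᵢ = vᵢ₊₁`. For `n = 0` this is the vertex space, and for
`n ≥ 1` the vertices are determined by the edges, continuously, so that this is the space of
composable words of `n` edges with the topology from the product. -/
def Path (n : ℕ) : Type _ :=
  {p : (Fin (n + 1) → V) × (Fin n → D) //
    ∀ i : Fin n, E.r (p.2 i) = p.1 i.castSucc ∧ E.s (p.2 i) = p.1 i.succ}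

instance (n : ℕ) : TopologicalSpace (E.Path n) := instTopologicalSpaceSubtype

/-- Infinite paths, recorded with all the vertices they visit. -/
def InfinitePath : Type _ :=
  {p : (ℕ → V) × (ℕ → D) // ∀ i : ℕ, E.r (p.2 i) = p.1 i ∧ E.s (p.2 i) = p.1 (i + 1)}

/-- The finite path space `E^*`, the topological disjoint union of the spaces of paths of
length `n`. -/
abbrev FinitePath : Type _ := Σ n : ℕ, E.Path n

variable {E}

/-- The source of a finite path: its last vertex. -/
def Path.source {n : ℕ} (p : E.Path n) : V := p.1.1 (Fin.last n)

/-- The range of a finite path: its first vertex. -/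
def Path.range {n : ℕ} (p : E.Path n) : V := p.1.1 0

/-- The range of an infinite path: its first vertex. -/
def InfinitePath.range (p : E.InfinitePath) : V := p.1.1 0

/-- The initial segment consisting of the first `k` edges (for `k = 0`, the range vertex). -/
def Path.take {n : ℕ} (p : E.Path n) (k : ℕ) (h : k ≤ n) : E.Path k :=
  ⟨(fun i => p.1.1 (i.castLE (Nat.succ_le_succ h)), fun i => p.1.2 (i.castLE h)),
    fun i => p.2 (i.castLE h)⟩

/-- The initial segment consisting of the first `k` edges (for `k = 0`, the range vertex). -/
def InfinitePath.take (p : E.InfinitePath) (k : ℕ) : E.Path k :=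
  ⟨(fun i => p.1.1 i, fun i => p.1.2 i), fun i => p.2 i⟩

/-- Removing the first edge (from a path with one edge, this leaves the source vertex). -/
def Path.tail {n : ℕ} (p : E.Path (n + 1)) : E.Path n :=
  ⟨(fun i => p.1.1 i.succ, fun i => p.1.2 i.succ), fun i => p.2 i.succ⟩

/-- Removing the first edge. -/
def InfinitePath.tail (p : E.InfinitePath) : E.InfinitePath :=
  ⟨(fun i => p.1.1 (i + 1), fun i => p.1.2 (i + 1)), fun i => p.2 (i + 1)⟩

theorem Path.source_tail {n : ℕ} (p : E.Path (n + 1)) : p.tail.source = p.source := rfl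

variable (E)

/-- The boundary path space `∂E`: finite paths with singular source, and infinite paths. -/
inductive BoundaryPath : Type _
  | finite (n : ℕ) (p : E.Path n) (h : p.source ∈ E.singular) : BoundaryPath
  | infinite (p : E.InfinitePath) : BoundaryPath

variable {E}

namespace BoundaryPath

/-- The range map `∂E → E⁰`. -/
def range : E.BoundaryPath → V
  | finite _ p _ => p.range
  | infinite p => p.range

/-- All finite initial segments of a boundary path, including the range vertex, and the path
itself if it is finite. -/
def prefixes : E.BoundaryPath → Set E.FinitePath
  | finite n p _ => {q | ∃ (k : ℕ) (h : k ≤ n), q = ⟨k, p.take k h⟩}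
  | infinite p => {q | ∃ k : ℕ, q = ⟨k, p.take k⟩}

/-- `Z(S)`: the boundary paths having an initial segment in `S`. -/
def Z (S : Set E.FinitePath) : Set E.BoundaryPath :=
  {α | ∃ q ∈ α.prefixes, q ∈ S}

/-- The topology on `∂E` generated by the sets `Z(U) \ Z(K)` with `U` open and `K` compact in the
finite path space. -/
instance : TopologicalSpace E.BoundaryPath :=
  TopologicalSpace.generateFrom
    {A | ∃ U K : Set E.FinitePath, IsOpen U ∧ IsCompact K ∧ A = Z U \ Z K}

instance : MeasurableSpace E.BoundaryPath := borel _

instance : BorelSpace E.BoundaryPath := ⟨rfl⟩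

variable (E) in
/-- The boundary paths of length zero, that is, `∂E ∩ E⁰`. -/
def vertices : Set E.BoundaryPath :=
  {α | ∃ (p : E.Path 0) (h : p.source ∈ E.singular), α = finite 0 p h}

/-- The backward shift `σ : ∂E \ E⁰ → ∂E`, which removes the first edge. -/
def shift : ((vertices E)ᶜ : Set E.BoundaryPath) → E.BoundaryPath
  | ⟨finite 0 p h, hα⟩ => (hα ⟨p, h, rfl⟩).elim
  | ⟨finite (n + 1) p h, _⟩ => finite n p.tail (p.source_tail ▸ h)
  | ⟨infinite p, _⟩ => infinite p.tail

end BoundaryPath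

/-- An invariant measure on `E`: a Radon probability measure `μ` on the vertex space with
`∫ f ∘ r d(s^*μ) ≤ ∫ f dμ` for all `f ≥ 0` in `C_c`, with equality if `supp f` consists of regular
vertices. The integrals are those of nonnegative functions, with values in `[0, ∞]`. -/
structure IsInvariantMeasure [MeasurableSpace V] [BorelSpace V] [MeasurableSpace D] [BorelSpace D]
    (E : TopologicalGraph V D) (μ : Measure V) : Prop where
  isProbabilityMeasure : IsProbabilityMeasure μ
  regular : μ.Regular
  lintegral_le : ∀ f : C_c(V, ℝ), (∀ v, 0 ≤ f v) →
    ∫⁻ e, ENNReal.ofReal (f (E.r e)) ∂(radonPullback E.s μ) ≤ ∫⁻ v, ENNReal.ofReal (f v) ∂μ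
  lintegral_eq : ∀ f : C_c(V, ℝ), (∀ v, 0 ≤ f v) → tsupport f ⊆ E.regular →
    ∫⁻ e, ENNReal.ofReal (f (E.r e)) ∂(radonPullback E.s μ) = ∫⁻ v, ENNReal.ofReal (f v) ∂μ

end TopologicalGraph

namespace TopologicalGraph

variable {V D : Type*} [TopologicalSpace V] [T2Space V] [LocallyCompactSpace V]
  [TopologicalSpace D] [T2Space D] [LocallyCompactSpace D] {E : TopologicalGraph V D}

/-! The range map `∂E → E⁰` is a proper surjection. Recording a boundary path by its initial
segments, with the value `∞` beyond its length, embeds `∂E` in the product of the one-point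
compactifications of the spaces `Eⁿ`. The paths with range in a compact set have closed image
(`isClosed_coherent`), because properness of `r` over regular vertices prevents a path from stopping
at a regular vertex in the limit. Moreover, a boundary path of positive length is an edge followed
by a boundary path (`homeomorphPullback`), so the shift is the base change of `s` along the range
map, hence a local homeomorphism.

Write `λ = μ - r_*(s^*μ)`. Invariance makes this a positive measure vanishing on the regular
vertices, so it can be placed on the boundary paths of length zero. If `M` on `∂E` has image `μ`
under the range map, then so does `M' = σ^*M + λ`: by base change the first-edge map sends `σ^*M` to
`s^*μ`, whose image under `r` is `μ - λ` (`map_firstEdge_radonPullback`, `exists_next`). Off `E⁰`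
the measure `M'` agrees with `σ^*M`.

It remains to find a fixed point of `M ↦ M'`. A first lift of `μ` comes from positive extension of
functionals (`exists_regular_lift`). Iterating from it and taking an ultrafilter limit of Cesàro
averages gives a positive functional on `C_c(∂E)` with the required invariance
(`exists_limit_of_averages`), and the Riesz theorem turns it into a Radon measure. No mass escapes
in the limit: every iterate has image `μ`, and `f ∘ r` is compactly supported for `f ∈ C_c(E⁰)`. -/

theorem continuous_s (E : TopologicalGraph V D) : Continuous E.s := E.isLocalHomeomorph_s.continuous

/-! ### The spaces of finite paths -/

namespace Path

variable {n : ℕ}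

@[ext]
theorem ext {p q : E.Path n} (hv : ∀ i, p.1.1 i = q.1.1 i) (he : ∀ i, p.1.2 i = q.1.2 i) :
    p = q :=
  Subtype.ext (Prod.ext (funext hv) (funext he))

theorem continuous_vertex (i : Fin (n + 1)) : Continuous fun p : E.Path n => p.1.1 i :=
  (continuous_apply i).comp (continuous_fst.comp continuous_subtype_val)

theorem continuous_edge (i : Fin n) : Continuous fun p : E.Path n => p.1.2 i :=
  (continuous_apply i).comp (continuous_snd.comp continuous_subtype_val)

theorem continuous_iff {X : Type*} [TopologicalSpace X] {f : X → E.Path n} :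
    Continuous f ↔ (∀ i, Continuous fun x => (f x).1.1 i) ∧ ∀ i, Continuous fun x => (f x).1.2 i :=
  ⟨fun h => ⟨fun i => (continuous_vertex i).comp h, fun i => (continuous_edge i).comp h⟩,
    fun h => continuous_induced_rng.2 ((continuous_pi h.1).prodMk (continuous_pi h.2))⟩

theorem isClosedEmbedding_val : IsClosedEmbedding (Subtype.val : E.Path n → _) := by
  refine IsClosed.isClosedEmbedding_subtypeVal ?_
  change IsClosed {p : (Fin (n + 1) → V) × (Fin n → D) |
    ∀ i : Fin n, E.r (p.2 i) = p.1 i.castSucc ∧ E.s (p.2 i) = p.1 i.succ}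
  rw [Set.ofPred_forall]
  refine isClosed_iInter fun i => IsClosed.inter (isClosed_eq ?_ ?_) (isClosed_eq ?_ ?_)
  · exact E.continuous_r.comp ((continuous_apply i).comp continuous_snd)
  · exact (continuous_apply _).comp continuous_fst
  · exact E.continuous_s.comp ((continuous_apply i).comp continuous_snd)
  · exact (continuous_apply _).comp continuous_fst

instance : T2Space (E.Path n) := isClosedEmbedding_val.isEmbedding.t2Space

instance : LocallyCompactSpace (E.Path n) := isClosedEmbedding_val.locallyCompactSpace

/-- Bounded in every coordinate, such a set is a closed subset of a product of compact sets, by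
Tychonoff and `isClosedEmbedding_val`. -/
theorem isCompact_of_isClosed {S : Set (E.Path n)} (hS : IsClosed S)
    (hv : ∀ i, ∃ A : Set V, IsCompact A ∧ ∀ p ∈ S, p.1.1 i ∈ A)
    (he : ∀ i, ∃ B : Set D, IsCompact B ∧ ∀ p ∈ S, p.1.2 i ∈ B) : IsCompact S := by
  choose A hA hAS using hv
  choose B hB hBS using he
  have hc : IsCompact ((Set.univ.pi A) ×ˢ (Set.univ.pi B)) :=
    (isCompact_univ_pi hA).prod (isCompact_univ_pi hB)
  refine (isClosedEmbedding_val.isCompact_preimage hc).of_isClosed_subset hS fun p hp => ?_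
  exact ⟨fun i _ => hAS i p hp, fun i _ => hBS i p hp⟩

/-- Adding an edge in front of a path. -/
def cons (e : D) (p : E.Path n) (h : E.s e = p.range) : E.Path (n + 1) :=
  ⟨(Fin.cons (E.r e) p.1.1, Fin.cons e p.1.2), fun i => by
    refine Fin.cases ⟨rfl, h⟩ (fun i => ?_) i
    simpa using p.2 i⟩

theorem s_edge_zero (p : E.Path (n + 1)) : E.s (p.1.2 0) = p.tail.range := (p.2 0).2

theorem cons_edge_tail (p : E.Path (n + 1)) : cons (p.1.2 0) p.tail p.s_edge_zero = p := by
  ext i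
  · exact Fin.cases (p.2 0).1 (fun i => rfl) i
  · exact Fin.cases rfl (fun i => rfl) i

theorem continuous_tail : Continuous (tail : E.Path (n + 1) → E.Path n) :=
  continuous_iff.2 ⟨fun _ => continuous_vertex _, fun _ => continuous_edge _⟩

theorem continuous_take (k : ℕ) (h : k ≤ n) : Continuous fun p : E.Path n => p.take k h :=
  continuous_iff.2 ⟨fun _ => continuous_vertex _, fun _ => continuous_edge _⟩

theorem continuous_range : Continuous (range : E.Path n → V) := continuous_vertex _

theorem continuous_source : Continuous (source : E.Path n → V) := continuous_vertex _

theorem continuous_cons {X : Type*} [TopologicalSpace X] {e : X → D} {p : X → E.Path n}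
    (he : Continuous e) (hp : Continuous p) (h : ∀ x, E.s (e x) = (p x).range) :
    Continuous fun x => cons (e x) (p x) (h x) := by
  refine continuous_iff.2 ⟨fun i => ?_, fun i => ?_⟩
  · exact Fin.cases (E.continuous_r.comp he) (fun i => (continuous_vertex i).comp hp) i
  · exact Fin.cases he (fun i => (continuous_edge i).comp hp) i

/-- The paths with first edge in `C` and tail in `K` form a compact set. -/
theorem isCompact_edge_tail {C : Set D} {K : Set (E.Path n)} (hC : IsCompact C)
    (hK : IsCompact K) : IsCompact {p : E.Path (n + 1) | p.1.2 0 ∈ C ∧ p.tail ∈ K} := by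
  refine isCompact_of_isClosed ?_ ?_ ?_
  · exact (hC.isClosed.preimage (continuous_edge 0)).inter (hK.isClosed.preimage continuous_tail)
  · refine fun i => Fin.cases ⟨_, hC.image E.continuous_r, fun p hp => ?_⟩
      (fun i => ⟨_, hK.image (continuous_vertex i), fun p hp => ⟨_, hp.2, rfl⟩⟩) i
    exact ⟨_, hp.1, (p.2 0).1⟩
  · exact fun i => Fin.cases ⟨C, hC, fun p hp => hp.1⟩
      (fun i => ⟨_, hK.image (continuous_edge i), fun p hp => ⟨_, hp.2, rfl⟩⟩) i

/-- The paths with last edge in `C` and the other edges forming a path in `K` form a compact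
set. -/
theorem isCompact_take_edge {C : Set D} {K : Set (E.Path n)} (hC : IsCompact C)
    (hK : IsCompact K) :
    IsCompact {p : E.Path (n + 1) | p.take n n.le_succ ∈ K ∧ p.1.2 (Fin.last n) ∈ C} := by
  refine isCompact_of_isClosed ?_ ?_ ?_
  · exact (hK.isClosed.preimage (continuous_take n _)).inter
      (hC.isClosed.preimage (continuous_edge _))
  · refine fun i => Fin.lastCases ⟨_, hC.image E.continuous_s, fun p hp => ?_⟩
      (fun i => ⟨_, hK.image (continuous_vertex i), fun p hp => ⟨_, hp.1, rfl⟩⟩) i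
    exact ⟨_, hp.2, (p.2 (Fin.last n)).2⟩
  · exact fun i => Fin.lastCases ⟨C, hC, fun p hp => hp.2⟩
      (fun i => ⟨_, hK.image (continuous_edge i), fun p hp => ⟨_, hp.1, rfl⟩⟩) i

/-- The path of length zero at a vertex. -/
def ofVertex (v : V) : E.Path 0 := ⟨(fun _ => v, Fin.elim0), fun i => i.elim0⟩

theorem continuous_ofVertex : Continuous (ofVertex : V → E.Path 0) :=
  continuous_iff.2 ⟨fun _ => continuous_id, fun i => i.elim0⟩

theorem ofVertex_range (p : E.Path 0) : ofVertex p.range = p := by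
  ext i
  · exact Fin.cases rfl (fun i => i.elim0) i
  · exact i.elim0

end Path

/-! ### Regular vertices -/

theorem isOpen_regular : IsOpen E.regular := isOpen_sUnion fun _ hU => hU.1

theorem exists_r_eq {v : V} (hv : v ∈ E.regular) : ∃ e, E.r e = v := by
  obtain ⟨U, ⟨-, -, hU⟩, hvU⟩ := hv
  obtain ⟨e, he⟩ := hU ⟨v, hvU⟩
  exact ⟨e.1, congrArg Subtype.val he⟩

theorem exists_isCompact_preimage_r {v : V} (hv : v ∈ E.regular) :
    ∃ C ∈ 𝓝 v, IsCompact (E.r ⁻¹' C) := by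
  obtain ⟨U, ⟨hU, hp, -⟩, hvU⟩ := hv
  obtain ⟨C, hC, hCU, hCc⟩ := local_compact_nhds (hU.mem_nhds hvU)
  refine ⟨C, hC, ?_⟩
  have h1 : IsCompact ((Subtype.val : U → V) ⁻¹' C) :=
    IsInducing.subtypeVal.isCompact_preimage_iff (by simpa using hCU) |>.2 hCc
  have h2 := (hp.isCompact_preimage h1).image continuous_subtype_val
  convert h2 using 1
  ext e
  exact ⟨fun he => ⟨⟨e, hCU he⟩, he, rfl⟩, by rintro ⟨e, he, rfl⟩; exact he⟩

/-! ### The topology of the boundary path space -/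

namespace BoundaryPath

/-- The initial segment of length `n`, or `∞` if the path is shorter than `n`. -/
noncomputable def initial : E.BoundaryPath → ∀ n, OnePoint (E.Path n)
  | finite m p _, n => if h : n ≤ m then (p.take n h : E.Path n) else OnePoint.infty
  | infinite p, n => (p.take n : E.Path n)

theorem initial_finite_of_le {m n : ℕ} {p : E.Path m} {hp : p.source ∈ E.singular} (h : n ≤ m) :
    (finite m p hp).initial n = (p.take n h : E.Path n) := dif_pos h

theorem initial_finite_of_lt {m n : ℕ} {p : E.Path m} {hp : p.source ∈ E.singular} (h : m < n) :
    (finite m p hp).initial n = OnePoint.infty := dif_neg h.not_ge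

theorem initial_infinite {n : ℕ} {p : E.InfinitePath} :
    (infinite p).initial n = (p.take n : E.Path n) := rfl

theorem mem_prefixes {α : E.BoundaryPath} {n : ℕ} {q : E.Path n} :
    (⟨n, q⟩ : E.FinitePath) ∈ α.prefixes ↔ α.initial n = q := by
  cases α with
  | finite m p hp =>
    constructor
    · rintro ⟨k, hk, h⟩
      obtain ⟨rfl, h⟩ := Sigma.mk.inj h
      rw [initial_finite_of_le hk, eq_of_heq h]
    · intro h
      by_cases hn : n ≤ m
      · rw [initial_finite_of_le hn, OnePoint.coe_eq_coe] at h
        exact ⟨n, hn, by rw [h]⟩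
      · rw [initial_finite_of_lt (not_le.1 hn)] at h
        exact absurd h.symm (OnePoint.coe_ne_infty q)
  | infinite p =>
    constructor
    · rintro ⟨k, h⟩
      obtain ⟨rfl, h⟩ := Sigma.mk.inj h
      rw [initial_infinite, eq_of_heq h]
    · intro h
      rw [initial_infinite, OnePoint.coe_eq_coe] at h
      exact ⟨n, by rw [h]⟩

theorem mem_Z {α : E.BoundaryPath} {S : Set E.FinitePath} :
    α ∈ Z S ↔ ∃ (n : ℕ) (q : E.Path n), α.initial n = q ∧ (⟨n, q⟩ : E.FinitePath) ∈ S := by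
  constructor
  · rintro ⟨⟨n, q⟩, h, hS⟩
    exact ⟨n, q, mem_prefixes.1 h, hS⟩
  · rintro ⟨n, q, h, hS⟩
    exact ⟨⟨n, q⟩, mem_prefixes.2 h, hS⟩

theorem initial_zero (α : E.BoundaryPath) : α.initial 0 = (Path.ofVertex α.range : E.Path 0) := by
  cases α with
  | finite m p hp =>
    rw [initial_finite_of_le (Nat.zero_le m), ← Path.ofVertex_range (p.take 0 _)]; rfl
  | infinite p => rw [initial_infinite, ← Path.ofVertex_range (p.take 0)]; rfl

theorem initial_of_initial_succ {α : E.BoundaryPath} {n : ℕ} {q : E.Path (n + 1)}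
    (h : α.initial (n + 1) = q) : α.initial n = (q.take n n.le_succ : E.Path n) := by
  cases α with
  | finite m p hp =>
    by_cases hn : n + 1 ≤ m
    · rw [initial_finite_of_le hn, OnePoint.coe_eq_coe] at h
      rw [initial_finite_of_le (n.le_succ.trans hn), ← h]; rfl
    · rw [initial_finite_of_lt (not_le.1 hn)] at h
      exact absurd h.symm (OnePoint.coe_ne_infty q)
  | infinite p =>
    rw [initial_infinite, OnePoint.coe_eq_coe] at h
    rw [initial_infinite, ← h]; rfl

/-- A finite boundary path ends at a singular vertex, so an initial segment ending at a regular one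
has to continue. -/
theorem initial_succ_ne_infty {α : E.BoundaryPath} {n : ℕ} {q : E.Path n}
    (h : α.initial n = q) (hq : q.source ∈ E.regular) : α.initial (n + 1) ≠ OnePoint.infty := by
  cases α with
  | finite m p hp =>
    by_cases hn : n ≤ m
    · rcases hn.lt_or_eq with hn' | rfl
      · rw [initial_finite_of_le (show n + 1 ≤ m from hn')]
        exact OnePoint.coe_ne_infty _
      · rw [initial_finite_of_le hn, OnePoint.coe_eq_coe] at h
        subst h
        exact absurd hq hp
    · rw [initial_finite_of_lt (not_le.1 hn)] at h
      exact absurd h.symm (OnePoint.coe_ne_infty q)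
  | infinite p => exact OnePoint.coe_ne_infty _

theorem initial_injective : Function.Injective (initial (E := E)) := by
  intro α β h
  have h' : ∀ n, α.initial n = β.initial n := fun n => congrFun h n
  have key : ∀ {m m' : ℕ} {p : E.Path m} {p' : E.Path m'} {hp : p.source ∈ E.singular}
      {hp' : p'.source ∈ E.singular}, (finite m p hp).initial m = (finite m' p' hp').initial m →
      m ≤ m' := by
    intro m m' p p' hp hp' h
    by_contra hm
    rw [initial_finite_of_le le_rfl, initial_finite_of_lt (not_le.1 hm)] at h
    exact OnePoint.coe_ne_infty _ h
  cases α with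
  | finite m p hp =>
    cases β with
    | finite m' p' hp' =>
      obtain rfl : m = m' := le_antisymm (key (h' m)) (key (h' m').symm)
      have := h' m
      rw [initial_finite_of_le le_rfl, initial_finite_of_le le_rfl, OnePoint.coe_eq_coe] at this
      obtain rfl : p = p' := this
      rfl
    | infinite p' =>
      -- A path of length `m` has `∞` at index `m + 1`, whereas an infinite path never does.
      have := h' (m + 1)
      rw [initial_finite_of_lt m.lt_succ_self, initial_infinite] at this
      exact absurd this.symm (OnePoint.coe_ne_infty _)
  | infinite p =>
    cases β with
    | finite m p' hp' =>
      have := h' (m + 1)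
      rw [initial_finite_of_lt m.lt_succ_self, initial_infinite] at this
      exact absurd this (OnePoint.coe_ne_infty _)
    | infinite p' =>
      have h2 : ∀ n, p.take n = p'.take n := fun n => OnePoint.coe_eq_coe.1 (h' n)
      congr 1
      refine Subtype.ext (Prod.ext (funext fun n => ?_) (funext fun n => ?_))
      · exact congrFun (congrArg (fun q => q.1.1) (h2 n)) (Fin.last n)
      · exact congrFun (congrArg (fun q => q.1.2) (h2 (n + 1))) (Fin.last n)

variable (E) in
/-- The sequences of initial segments of boundary paths with range in `C`; see
`image_initial`. -/
def coherent (C : Set V) : Set (∀ n, OnePoint (E.Path n)) :=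
  {x | (∃ v ∈ C, x 0 = (Path.ofVertex v : E.Path 0)) ∧
    (∀ n, x (n + 1) ≠ OnePoint.infty →
      OnePoint.map (fun q : E.Path (n + 1) => q.take n n.le_succ) (x (n + 1)) = x n) ∧
    ∀ (n) (q : E.Path n), x n = q → q.source ∈ E.regular → x (n + 1) ≠ OnePoint.infty}

theorem exists_initial_eq {C : Set V} {x : ∀ n, OnePoint (E.Path n)} (hx : x ∈ coherent E C) :
    ∃ α : E.BoundaryPath, α.initial = x := by
  obtain ⟨⟨v, hv, h0⟩, h1, h2⟩ := hx
  by_cases h : ∀ n, x n ≠ OnePoint.infty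
  · choose q hq using fun n => OnePoint.ne_infty_iff_exists.1 (h n)
    have hqt : ∀ n, (q (n + 1)).take n n.le_succ = q n := fun n => by
      have := h1 n (h _)
      rwa [← hq, ← hq, OnePoint.map_some, OnePoint.coe_eq_coe] at this
    have hv : ∀ n (i : Fin (n + 1)), (q (n + 1)).1.1 i.castSucc = (q n).1.1 i := fun n i =>
      congrFun (congrArg (fun q => q.1.1) (hqt n)) i
    have he : ∀ n (i : Fin n), (q (n + 1)).1.2 i.castSucc = (q n).1.2 i := fun n i =>
      congrFun (congrArg (fun q => q.1.2) (hqt n)) i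
    let p : E.InfinitePath := ⟨(fun n => (q n).1.1 (Fin.last n),
      fun n => (q (n + 1)).1.2 (Fin.last n)), fun n =>
      ⟨((q (n + 1)).2 (Fin.last n)).1.trans (hv n _), ((q (n + 1)).2 (Fin.last n)).2⟩⟩
    have hp : ∀ n, p.take n = q n := fun n => by
      induction n with
      | zero =>
        ext i
        · exact Fin.cases rfl (fun i => i.elim0) i
        · exact i.elim0
      | succ n ih =>
        ext i
        · refine Fin.lastCases rfl (fun i => ?_) i
          rw [hv, ← ih]; rfl
        · refine Fin.lastCases rfl (fun i => ?_) i
          rw [he, ← ih]; rfl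
    exact ⟨infinite p, funext fun n => by rw [initial_infinite, hp, hq]⟩
  · push Not at h
    classical
    -- The first index with value `∞` is some `k + 1`, since `x 0` is a vertex. The candidate path
    -- is then `x k`, and the last coherence condition forces its source to be singular.
    obtain ⟨hm, hlt⟩ := And.intro (Nat.find_spec h) fun k => Nat.find_min h (m := k)
    obtain ⟨k, hk⟩ : ∃ k, Nat.find h = k + 1 := by
      refine Nat.exists_eq_succ_of_ne_zero fun h' => ?_
      rw [h', h0] at hm
      exact OnePoint.coe_ne_infty _ hm
    rw [hk] at hm hlt
    obtain ⟨q, hq⟩ := OnePoint.ne_infty_iff_exists.1 (hlt k k.lt_succ_self)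
    have hsng : q.source ∈ E.singular := fun hreg => h2 k q hq.symm hreg hm
    refine ⟨finite k q hsng, funext fun n => ?_⟩
    rcases le_or_gt n k with hn | hn
    -- Below `k` each entry is determined by the next one; above `k` the value `∞` persists, because
    -- a finite entry truncates to a finite entry.
    · induction hn using Nat.decreasingInduction with
      | self => rw [initial_finite_of_le le_rfl, ← hq]; rfl
      | of_succ n hn ih =>
        rw [initial_finite_of_le (show n + 1 ≤ k from hn)] at ih
        rw [initial_finite_of_le hn.le, ← h1 n (by rw [← ih]; exact OnePoint.coe_ne_infty _), ← ih]
        rfl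
    · rw [initial_finite_of_lt hn]
      symm
      induction n, hn using Nat.le_induction with
      | base => exact hm
      | succ n hn ih =>
        by_contra hne
        have := h1 n hne
        obtain ⟨p, hp⟩ := OnePoint.ne_infty_iff_exists.1 hne
        rw [ih, ← hp, OnePoint.map_some] at this
        exact OnePoint.coe_ne_infty _ this

theorem image_initial (C : Set V) :
    initial '' (range ⁻¹' C : Set E.BoundaryPath) = coherent E C := by
  refine Set.Subset.antisymm ?_ fun x hx => ?_
  · rintro _ ⟨α, hα, rfl⟩
    refine ⟨⟨_, hα, initial_zero α⟩, fun n hn => ?_, fun n _ => initial_succ_ne_infty⟩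
    obtain ⟨q, hq⟩ := OnePoint.ne_infty_iff_exists.1 hn
    rw [← hq, OnePoint.map_some, initial_of_initial_succ hq.symm]
  · obtain ⟨α, rfl⟩ := exists_initial_eq hx
    obtain ⟨v, hv, h0⟩ := hx.1
    rw [initial_zero, OnePoint.coe_eq_coe] at h0
    refine ⟨α, ?_, rfl⟩
    have : α.range = v := congrArg Path.range h0
    rwa [Set.mem_preimage, this]

/-- Closedness of the last condition is where properness of `r` over regular vertices enters; the
other two survive limits by compactness of `C` and continuity of truncation. -/
theorem isClosed_coherent {C : Set V} (hC : IsCompact C) : IsClosed (coherent E C) := by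
  refine isClosed_of_closure_subset fun x hx => ?_
  have hne : (𝓝[coherent E C] x).NeBot := mem_closure_iff_nhdsWithin_neBot.1 hx
  have hlim : ∀ n, Filter.Tendsto (fun y : ∀ n, OnePoint (E.Path n) => y n)
      (𝓝[coherent E C] x) (𝓝 (x n)) := fun n =>
    (continuous_apply n).continuousAt.mono_left nhdsWithin_le_nhds
  have hmem : ∀ᶠ y in 𝓝[coherent E C] x, y ∈ coherent E C := self_mem_nhdsWithin
  have hcomp : ∀ n, x (n + 1) ≠ OnePoint.infty →
      OnePoint.map (fun q : E.Path (n + 1) => q.take n n.le_succ) (x (n + 1)) = x n := by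
    intro n hn
    -- Truncation need not be proper, so its extension is continuous only at finite points in
    -- general; this is why the coherence condition excludes `∞`.
    have hcont : ContinuousAt (OnePoint.map fun q : E.Path (n + 1) => q.take n n.le_succ)
        (x (n + 1)) := by
      obtain ⟨q, hq⟩ := OnePoint.ne_infty_iff_exists.1 hn
      rw [← hq, OnePoint.continuousAt_coe]
      exact (OnePoint.continuous_coe.comp (Path.continuous_take n _)).continuousAt
    have h2 := (hlim (n + 1)).eventually_ne hn
    refine tendsto_nhds_unique_of_eventuallyEq (hcont.tendsto.comp (hlim (n + 1))) (hlim n) ?_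
    filter_upwards [h2, hmem] with y hy1 hy2 using hy2.2.1 n hy1
  refine ⟨?_, hcomp, fun n q hq hreg hinf => ?_⟩
  · have hK : IsClosed ((fun v => ((Path.ofVertex v : E.Path 0) : OnePoint (E.Path 0))) '' C) :=
      (hC.image (OnePoint.continuous_coe.comp Path.continuous_ofVertex)).isClosed
    obtain ⟨v, hv, h⟩ := hK.mem_of_tendsto (hlim 0) (hmem.mono fun y hy => by
      obtain ⟨v, hv, h⟩ := hy.1
      exact ⟨v, hv, h.symm⟩)
    exact ⟨v, hv, h.symm⟩
  -- Suppose `x n = q` has regular source and `x (n + 1) = ∞`. Near `x`, the `n`-th entry lies in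
  -- the compact set `N`, with source in `A`, so the next edge lies in the compact set `r⁻¹(A)`. The
  -- `(n + 1)`-st entry is then confined to a compact set of paths and cannot approach `∞`.
  · obtain ⟨A, hA, hAc⟩ := exists_isCompact_preimage_r hreg
    obtain ⟨N, hN, hNA, hNc⟩ := local_compact_nhds
      (Path.continuous_source.continuousAt.preimage_mem_nhds
        (Filter.inter_mem hA (isOpen_regular.mem_nhds hreg)) : _ ∈ 𝓝 q)
    have hK := Path.isCompact_take_edge hAc hNc
    have h1 : ∀ᶠ y in 𝓝[coherent E C] x, y n ∈ ((↑) : E.Path n → OnePoint (E.Path n)) '' N := by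
      refine hlim n ?_
      rw [hq, OnePoint.nhds_coe_eq]
      exact Filter.image_mem_map hN
    have h2 := (hlim (n + 1)).eventually ((OnePoint.isOpen_compl_image_coe.2 ⟨hK.isClosed, hK⟩).mem_nhds
      (by rw [hinf]; exact OnePoint.infty_notMem_image_coe))
    obtain ⟨y, ⟨q', hq'N, hq'⟩, hy2, -, hy3, hy4⟩ := (h1.and (h2.and hmem)).exists
    have hyne := hy4 n q' hq'.symm (hNA hq'N).2
    have hyt := hy3 n hyne
    obtain ⟨p, hp⟩ := OnePoint.ne_infty_iff_exists.1 hyne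
    rw [← hp, ← hq', OnePoint.map_some, OnePoint.coe_eq_coe] at hyt
    refine hy2 ⟨p, ⟨by rw [hyt]; exact hq'N, ?_⟩, hp⟩
    have : E.r (p.1.2 (Fin.last n)) = q'.source := by
      rw [← hyt]; exact (p.2 (Fin.last n)).1
    rw [Set.mem_preimage, this]
    exact (hNA hq'N).1

/-! ### The topology of `∂E` as the one induced by initial segments -/

theorem preimage_initial_coe (n : ℕ) (S : Set (E.Path n)) :
    (fun α : E.BoundaryPath => α.initial n) ⁻¹' (((↑) : _ → OnePoint (E.Path n)) '' S) =
      Z (Sigma.mk n '' S) := by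
  ext α
  rw [mem_Z]
  constructor
  · rintro ⟨q, hq, h⟩
    exact ⟨n, q, h.symm, q, hq, rfl⟩
  · rintro ⟨_, q, h, q', hq', h'⟩
    obtain ⟨rfl, h'⟩ := Sigma.mk.inj h'
    rw [← eq_of_heq h'] at h
    exact ⟨q', hq', h.symm⟩

theorem isOpen_Z_diff {U K : Set E.FinitePath} (hU : IsOpen U) (hK : IsCompact K) :
    IsOpen (Z U \ Z K : Set E.BoundaryPath) :=
  TopologicalSpace.isOpen_generateFrom_of_mem ⟨U, K, hU, hK, rfl⟩

theorem isOpen_Z {U : Set E.FinitePath} (hU : IsOpen U) : IsOpen (Z U : Set E.BoundaryPath) := by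
  convert isOpen_Z_diff hU isCompact_empty using 1
  have : Z (∅ : Set E.FinitePath) = ∅ := Set.eq_empty_of_forall_notMem fun α h => by
    obtain ⟨_, _, -, h⟩ := mem_Z.1 h
    exact h
  rw [this, Set.sdiff_empty]

theorem isClosed_Z {K : Set E.FinitePath} (hK : IsCompact K) :
    IsClosed (Z K : Set E.BoundaryPath) := by
  have : Z (Set.univ : Set E.FinitePath) = Set.univ := Set.eq_univ_of_forall fun α =>
    mem_Z.2 ⟨0, _, initial_zero α, trivial⟩
  rw [← isOpen_compl_iff, Set.compl_eq_univ_sdiff, ← this]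
  exact isOpen_Z_diff isOpen_univ hK

theorem continuous_initial (n : ℕ) : Continuous fun α : E.BoundaryPath => α.initial n := by
  refine ⟨fun U hU => ?_⟩
  by_cases h : OnePoint.infty ∈ U
  · obtain ⟨h1, h2⟩ := (OnePoint.isOpen_iff_of_mem h).1 hU
    have h3 : U = (((↑) : E.Path n → OnePoint (E.Path n)) '' (((↑) : E.Path n → OnePoint (E.Path n)) ⁻¹' U)ᶜ)ᶜ := by
      ext x
      induction x using OnePoint.rec with
      | infty => simpa using h
      | coe q => simp
    rw [h3, Set.preimage_compl, preimage_initial_coe, isOpen_compl_iff]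
    exact isClosed_Z (h2.image continuous_sigmaMk)
  · have h1 := (OnePoint.isOpen_iff_of_notMem h).1 hU
    have h3 : U = ((↑) : E.Path n → OnePoint (E.Path n)) '' (((↑) : E.Path n → OnePoint (E.Path n)) ⁻¹' U) := by
      ext x
      induction x using OnePoint.rec with
      | infty => simpa using h
      | coe q => simp
    rw [h3, preimage_initial_coe]
    exact isOpen_Z (isOpenMap_sigmaMk _ h1)

/-- Open and compact subsets of `E^*` decompose by length, and at each length `Z` of a set is the
preimage under `initial n` of its image in the one-point compactification. -/
theorem isInducing_initial : IsInducing (initial (E := E)) := by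
  refine ⟨le_antisymm (continuous_iff_le_induced.1 (continuous_pi continuous_initial)) ?_⟩
  have hZ : ∀ (n : ℕ) (S : Set (OnePoint (E.Path n))), IsOpen S →
      IsOpen[TopologicalSpace.induced (initial (E := E)) inferInstance]
        ((fun α : E.BoundaryPath => α.initial n) ⁻¹' S) := fun n S hS =>
    isOpen_induced (hS.preimage (continuous_apply n))
  refine le_generateFrom ?_
  rintro _ ⟨U, K, hU, hK, rfl⟩
  have hun : ∀ S : Set E.FinitePath, Z S = ⋃ n, Z (Sigma.mk n '' (Sigma.mk n ⁻¹' S)) := fun S => by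
    ext α
    rw [Set.mem_iUnion]
    constructor
    · intro h
      obtain ⟨n, q, h, hS⟩ := mem_Z.1 h
      exact ⟨n, mem_Z.2 ⟨n, q, h, q, hS, rfl⟩⟩
    · rintro ⟨n, h⟩
      obtain ⟨m, q, h, q', hS, h'⟩ := mem_Z.1 h
      exact mem_Z.2 ⟨m, q, h, h' ▸ hS⟩
  rw [Set.sdiff_eq]
  refine @IsOpen.inter _ (TopologicalSpace.induced _ _) _ _ ?_ ?_
  · rw [hun]
    refine @isOpen_iUnion _ _ (TopologicalSpace.induced _ _) _ fun n => ?_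
    rw [← preimage_initial_coe]
    exact hZ n _ (OnePoint.isOpen_image_coe.2 (hU.preimage continuous_sigmaMk))
  -- A compact `K` meets only finitely many of the spaces `Eⁿ`, so the complement of `Z K` is a
  -- finite intersection of open sets.
  · obtain ⟨t, ht⟩ := hK.elim_finite_subcover (fun n => Set.range (Sigma.mk n : E.Path n → _))
      (fun n => isOpen_range_sigmaMk) fun q _ => Set.mem_iUnion.2 ⟨q.1, q.2, rfl⟩
    have : (Z K : Set E.BoundaryPath)ᶜ = ⋂ n ∈ t, (Z (Sigma.mk n '' (Sigma.mk n ⁻¹' K)))ᶜ := by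
      ext α
      simp only [Set.mem_iInter, Set.mem_compl_iff]
      constructor
      · intro h n _ h'
        rw [hun] at h
        exact h (Set.mem_iUnion.2 ⟨n, h'⟩)
      · intro h h'
        obtain ⟨n, q, hq, hK'⟩ := mem_Z.1 h'
        obtain ⟨m, hm, q', h''⟩ := Set.mem_iUnion₂.1 (ht hK')
        obtain ⟨rfl, -⟩ := Sigma.mk.inj h''
        exact h m hm (mem_Z.2 ⟨m, q, hq, q, hK', rfl⟩)
    rw [this]
    refine @isOpen_biInter_finset _ _ (TopologicalSpace.induced _ _) _ _ fun n _ => ?_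
    rw [← preimage_initial_coe, ← Set.preimage_compl]
    have hKn : IsCompact (Sigma.mk n ⁻¹' K : Set (E.Path n)) :=
      IsClosedEmbedding.sigmaMk.isCompact_preimage hK
    exact hZ n _ (OnePoint.isOpen_compl_image_coe.2 ⟨hKn.isClosed, hKn⟩)

/-! ### The range map is a proper surjection -/

instance : T2Space E.BoundaryPath :=
  (⟨isInducing_initial, initial_injective⟩ : IsEmbedding _).t2Space

theorem isCompact_preimage_range {C : Set V} (hC : IsCompact C) :
    IsCompact (range ⁻¹' C : Set E.BoundaryPath) := by
  rw [isInducing_initial.isCompact_iff, image_initial]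
  exact (isClosed_coherent hC).isCompact

theorem continuous_range : Continuous (range : E.BoundaryPath → V) := by
  have h : Continuous fun α : E.BoundaryPath => (Path.ofVertex α.range : E.Path 0) := by
    rw [OnePoint.isOpenEmbedding_coe.isEmbedding.continuous_iff]
    convert continuous_initial (E := E) 0 using 2 with α
    exact (initial_zero α).symm
  exact Path.continuous_range.comp h

instance : WeaklyLocallyCompactSpace E.BoundaryPath where
  exists_compact_mem_nhds α := by
    obtain ⟨C, hC, hα⟩ := exists_compact_mem_nhds α.range
    exact ⟨_, isCompact_preimage_range hC, continuous_range.continuousAt.preimage_mem_nhds hα⟩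

instance : LocallyCompactSpace E.BoundaryPath := inferInstance

/-- Starting from `v`, prepared edges are followed as long as the current vertex is regular. Either
this never stops, or it stops at a singular vertex; both outcomes are boundary paths. -/
theorem surjective_range : Function.Surjective (range : E.BoundaryPath → V) := by
  intro v
  classical
  rcases isEmpty_or_nonempty D with hD | hD
  -- Without edges there is no default value for the choice of edges below; in that case every
  -- vertex is singular.
  · have : v ∈ E.singular := fun hv => hD.elim (exists_r_eq hv).choose
    exact ⟨finite 0 (Path.ofVertex v) this, rfl⟩
  choose! e he using fun (w : V) (hw : w ∈ E.regular) => exists_r_eq hw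
  let w : ℕ → V := fun n => (fun u => E.s (e u))^[n] v
  have hw : ∀ n, E.s (e (w n)) = w (n + 1) := fun n =>
    (Function.iterate_succ_apply' (fun u => E.s (e u)) n v).symm
  by_cases h : ∀ n, w n ∈ E.regular
  · exact ⟨infinite ⟨(w, fun n => e (w n)), fun n => ⟨he _ (h n), hw n⟩⟩, rfl⟩
  · push Not at h
    refine ⟨finite (Nat.find h) ⟨(fun i => w i, fun i => e (w i)), fun i => ⟨he _ ?_, hw i⟩⟩
      (Nat.find_spec h), rfl⟩
    exact not_not.1 (Nat.find_min h i.2)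

end BoundaryPath

end TopologicalGraph

/-! ### Limits at infinity and base change of local homeomorphisms -/

section Pullback

theorem OnePoint.tendsto_infty_iff {X Y : Type*} [TopologicalSpace X] [T2Space X]
    {f : Y → OnePoint X} {l : Filter Y} :
    Filter.Tendsto f l (𝓝 OnePoint.infty) ↔
      ∀ K : Set X, IsCompact K → ∀ᶠ y in l, f y ∉ ((↑) : X → OnePoint X) '' K := by
  refine ⟨fun h K hK => ?_, fun h => ?_⟩
  · exact h.eventually ((OnePoint.isOpen_compl_image_coe.2 ⟨hK.isClosed, hK⟩).mem_nhds
      OnePoint.infty_notMem_image_coe)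
  · refine OnePoint.le_nhds_infty.2 fun K _ hK => ?_
    rw [← OnePoint.compl_image_coe]
    exact h K hK

/-- Openness and local injectivity of the projection are both inherited from `s`, and together with
continuity they characterise local homeomorphisms. -/
theorem isLocalHomeomorph_pullback_snd {X Y B : Type*} [TopologicalSpace X] [TopologicalSpace Y]
    [TopologicalSpace B] {s : X → Y} {g : B → Y} (hs : IsLocalHomeomorph s) (hg : Continuous g) :
    IsLocalHomeomorph fun x : {x : X × B // s x.1 = g x.2} => x.1.2 := by
  have hc : Continuous fun x : {x : X × B // s x.1 = g x.2} => x.1.2 :=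
    continuous_snd.comp continuous_subtype_val
  have ho : IsOpenMap fun x : {x : X × B // s x.1 = g x.2} => x.1.2 := by
    refine isOpenMap_iff_nhds_le.2 fun x N hN => ?_
    obtain ⟨W, hW, hWN⟩ := mem_nhds_subtype _ _ _ |>.1 hN
    obtain ⟨A, B', hA, hxA, hB, hxB, hAB⟩ := mem_nhds_prod_iff'.1 hW
    have h1 : g ⁻¹' (s '' A) ∈ 𝓝 x.1.2 :=
      ((hs.isOpenMap A hA).preimage hg).mem_nhds ⟨x.1.1, hxA, x.2⟩
    filter_upwards [h1, hB.mem_nhds hxB] with b hb1 hb2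
    obtain ⟨a, ha, hab⟩ := hb1
    exact hWN (show (⟨(a, b), hab⟩ : {x : X × B // s x.1 = g x.2}) ∈ _ from hAB ⟨ha, hb2⟩)
  refine isLocalHomeomorph_iff_isOpenEmbedding_restrict.2 fun x => ?_
  obtain ⟨U, hU, hxU, hUs⟩ := hs.isLocallyInjective x.1.1
  have hW : IsOpen ((fun x : {x : X × B // s x.1 = g x.2} => x.1.1) ⁻¹' U) :=
    hU.preimage (continuous_fst.comp continuous_subtype_val)
  refine ⟨_, hW.mem_nhds hxU, .of_continuous_injective_isOpenMap
    (hc.comp continuous_subtype_val) ?_ (ho.comp hW.isOpenMap_subtype_val)⟩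
  rintro ⟨⟨⟨a, b⟩, hab⟩, ha⟩ ⟨⟨⟨a', b'⟩, hab'⟩, ha'⟩ h
  obtain rfl : b = b' := h
  obtain rfl : a = a' := hUs ha ha' (hab.trans hab'.symm)
  rfl

end Pullback

namespace TopologicalGraph

variable {V D : Type*} [TopologicalSpace V] [T2Space V] [LocallyCompactSpace V]
  [TopologicalSpace D] [T2Space D] [LocallyCompactSpace D] {E : TopologicalGraph V D}

namespace BoundaryPath

/-! ### The shift as a base change of the source map -/

theorem mem_vertices {α : E.BoundaryPath} : α ∈ vertices E ↔ α.initial 1 = OnePoint.infty := by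
  constructor
  · rintro ⟨p, hp, rfl⟩
    exact initial_finite_of_lt zero_lt_one
  · intro h
    match α, h with
    | finite 0 p hp, _ => exact ⟨p, hp, rfl⟩
    | finite (n + 1) p hp, h =>
      rw [initial_finite_of_le (Nat.le_add_left 1 n)] at h
      exact absurd h (OnePoint.coe_ne_infty _)
    | infinite p, h => exact absurd h (OnePoint.coe_ne_infty _)

theorem isClosed_vertices : IsClosed (vertices E) := by
  have : vertices E = (fun α => α.initial 1) ⁻¹' {OnePoint.infty} := Set.ext fun α => mem_vertices
  rw [this]
  exact OnePoint.isClosed_infty.preimage (continuous_initial 1)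

instance : LocallyCompactSpace ((vertices E)ᶜ : Set E.BoundaryPath) :=
  isClosed_vertices.isOpen_compl.locallyCompactSpace

/-- The first edge of a boundary path of positive length. -/
def firstEdge : ((vertices E)ᶜ : Set E.BoundaryPath) → D
  | ⟨finite 0 p h, hα⟩ => (hα ⟨p, h, rfl⟩).elim
  | ⟨finite (_ + 1) p _, _⟩ => p.1.2 0
  | ⟨infinite p, _⟩ => p.1.2 0

/-- Adding an edge in front of a boundary path. -/
def cons : {x : D × E.BoundaryPath // E.s x.1 = x.2.range} →
    ((vertices E)ᶜ : Set E.BoundaryPath)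
  | ⟨(e, finite n p h), hx⟩ => ⟨finite (n + 1) (p.cons e hx) h, by
      rintro ⟨q, hq, h⟩
      injection h with h
      exact absurd h n.succ_ne_zero⟩
  | ⟨(e, infinite p), hx⟩ => ⟨infinite ⟨(fun n => Nat.casesOn n (E.r e) p.1.1,
      fun n => Nat.casesOn n e p.1.2), fun i => match i with
        | 0 => ⟨rfl, hx⟩
        | i + 1 => p.2 i⟩, by
      rintro ⟨q, hq, h⟩
      injection h⟩

theorem shift_cons (x : {x : D × E.BoundaryPath // E.s x.1 = x.2.range}) :
    shift (cons x) = x.1.2 := by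
  match x with
  | ⟨(e, finite n p h), hx⟩ => rfl
  | ⟨(e, infinite p), hx⟩ => rfl

theorem firstEdge_cons (x : {x : D × E.BoundaryPath // E.s x.1 = x.2.range}) :
    firstEdge (cons x) = x.1.1 := by
  match x with
  | ⟨(e, finite n p h), hx⟩ => rfl
  | ⟨(e, infinite p), hx⟩ => rfl

theorem range_cons (x : {x : D × E.BoundaryPath // E.s x.1 = x.2.range}) :
    (cons x).1.range = E.r x.1.1 := by
  match x with
  | ⟨(e, finite n p h), hx⟩ => rfl
  | ⟨(e, infinite p), hx⟩ => rfl

theorem s_firstEdge (β : ((vertices E)ᶜ : Set E.BoundaryPath)) :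
    E.s (firstEdge β) = (shift β).range := by
  match β with
  | ⟨finite 0 p h, hα⟩ => exact (hα ⟨p, h, rfl⟩).elim
  | ⟨finite (n + 1) p h, _⟩ => exact p.s_edge_zero
  | ⟨infinite p, _⟩ => exact (p.2 0).2

theorem r_firstEdge (β : ((vertices E)ᶜ : Set E.BoundaryPath)) :
    E.r (firstEdge β) = β.1.range := by
  match β with
  | ⟨finite 0 p h, hα⟩ => exact (hα ⟨p, h, rfl⟩).elim
  | ⟨finite (n + 1) p h, _⟩ => exact (p.2 0).1
  | ⟨infinite p, _⟩ => exact (p.2 0).1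

theorem cons_firstEdge_shift (β : ((vertices E)ᶜ : Set E.BoundaryPath)) :
    cons ⟨(firstEdge β, shift β), s_firstEdge β⟩ = β := by
  match β with
  | ⟨finite 0 p h, hα⟩ => exact (hα ⟨p, h, rfl⟩).elim
  | ⟨finite (n + 1) p h, _⟩ =>
    refine Subtype.ext ?_
    change finite (n + 1) (Path.cons (p.1.2 0) p.tail _) _ = finite (n + 1) p h
    congr 1
    exact p.cons_edge_tail
  | ⟨infinite p, _⟩ =>
    refine Subtype.ext (congrArg infinite (Subtype.ext (Prod.ext (funext fun n => ?_)
      (funext fun n => ?_))))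
    · cases n with
      | zero => exact (p.2 0).1
      | succ n => rfl
    · cases n with
      | zero => rfl
      | succ n => rfl

theorem initial_shift (β : ((vertices E)ᶜ : Set E.BoundaryPath)) (n : ℕ) :
    (shift β).initial n = OnePoint.map Path.tail (β.1.initial (n + 1)) := by
  match β with
  | ⟨finite 0 p h, hα⟩ => exact (hα ⟨p, h, rfl⟩).elim
  | ⟨finite (m + 1) p h, _⟩ =>
    suffices key : ∀ h', (finite m p.tail h').initial n =
        OnePoint.map Path.tail ((finite (m + 1) p h).initial (n + 1)) from key _
    intro h'
    rcases le_or_gt n m with hn | hn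
    · rw [initial_finite_of_le hn, initial_finite_of_le (Nat.succ_le_succ hn)]; rfl
    · rw [initial_finite_of_lt hn, initial_finite_of_lt (Nat.succ_lt_succ hn)]; rfl
  | ⟨infinite p, _⟩ => rfl

theorem edge_zero_of_initial_eq {β : ((vertices E)ᶜ : Set E.BoundaryPath)} {n : ℕ}
    {p : E.Path (n + 1)} (h : β.1.initial (n + 1) = p) : p.1.2 0 = firstEdge β := by
  match β, h with
  | ⟨finite 0 p h, hα⟩, _ => exact (hα ⟨p, h, rfl⟩).elim
  | ⟨finite (m + 1) q h, _⟩, h' =>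
    rcases le_or_gt (n + 1) (m + 1) with hn | hn
    · rw [initial_finite_of_le hn, OnePoint.coe_eq_coe] at h'
      rw [← h']; rfl
    · rw [initial_finite_of_lt hn] at h'
      exact absurd h'.symm (OnePoint.coe_ne_infty _)
  | ⟨infinite q, _⟩, h' =>
    rw [initial_infinite, OnePoint.coe_eq_coe] at h'
    rw [← h']; rfl

theorem continuous_firstEdge : Continuous (firstEdge (E := E)) := by
  choose p hp using fun β : ((vertices E)ᶜ : Set E.BoundaryPath) =>
    OnePoint.ne_infty_iff_exists.1 fun h => β.2 (mem_vertices.2 h)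
  have hc : Continuous p := by
    rw [OnePoint.isOpenEmbedding_coe.isEmbedding.continuous_iff]
    exact ((continuous_initial (E := E) 1).comp continuous_subtype_val).congr fun β => (hp β).symm
  exact ((Path.continuous_edge 0).comp hc).congr fun β => edge_zero_of_initial_eq (hp β).symm

theorem continuous_shift : Continuous (shift (E := E)) := by
  rw [isInducing_initial.continuous_iff]
  refine continuous_pi fun n => continuous_iff_continuousAt.2 fun β => ?_
  have hinit : ∀ m, Continuous fun γ : ((vertices E)ᶜ : Set E.BoundaryPath) => γ.1.initial m :=
    fun m => (continuous_initial m).comp continuous_subtype_val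
  simp only [Function.comp_apply, initial_shift]
  by_cases h : β.1.initial (n + 1) = OnePoint.infty
  · rw [ContinuousAt, h, OnePoint.map_infty, OnePoint.tendsto_infty_iff]
    intro K hK
    -- Removing the first edge is not a proper operation on paths, but it becomes proper once that
    -- edge is confined to a compact neighbourhood `C`.
    obtain ⟨C, hC, hCn⟩ := exists_compact_mem_nhds (firstEdge β)
    have h1 := continuous_firstEdge.continuousAt.eventually hCn
    have h2 := (hinit (n + 1)).continuousAt (x := β)
    rw [ContinuousAt, h, OnePoint.tendsto_infty_iff] at h2
    filter_upwards [h1, h2 _ (Path.isCompact_edge_tail hC hK)] with γ hγ1 hγ2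
    rintro ⟨k, hk, hkγ⟩
    by_cases hγ : γ.1.initial (n + 1) = OnePoint.infty
    · rw [hγ, OnePoint.map_infty] at hkγ
      exact OnePoint.coe_ne_infty _ hkγ
    · obtain ⟨p, hp⟩ := OnePoint.ne_infty_iff_exists.1 hγ
      rw [← hp, OnePoint.map_some, OnePoint.coe_eq_coe] at hkγ
      exact hγ2 ⟨p, ⟨by rw [edge_zero_of_initial_eq hp.symm]; exact hγ1, by rwa [← hkγ]⟩, hp⟩
  · have hc : ContinuousAt (OnePoint.map (Path.tail (E := E) (n := n)))
        (β.1.initial (n + 1)) := by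
      obtain ⟨p, hp⟩ := OnePoint.ne_infty_iff_exists.1 h
      rw [← hp, OnePoint.continuousAt_coe]
      exact (OnePoint.continuous_coe.comp Path.continuous_tail).continuousAt
    exact ContinuousAt.comp (f := fun γ : ((vertices E)ᶜ : Set E.BoundaryPath) =>
      γ.1.initial (n + 1)) hc (hinit _).continuousAt

theorem initial_cons (x : {x : D × E.BoundaryPath // E.s x.1 = x.2.range}) (n : ℕ) :
    x.1.2.initial n = OnePoint.map Path.tail ((cons x).1.initial (n + 1)) := by
  rw [← initial_shift, shift_cons]

theorem initial_cons_of_eq {x : {x : D × E.BoundaryPath // E.s x.1 = x.2.range}} {n : ℕ}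
    {q : E.Path n} (h : x.1.2.initial n = q) :
    ∃ hq : E.s x.1.1 = q.range, (cons x).1.initial (n + 1) = (q.cons x.1.1 hq : E.Path _) := by
  rw [initial_cons] at h
  have hne : (cons x).1.initial (n + 1) ≠ OnePoint.infty := fun h' => by
    rw [h', OnePoint.map_infty] at h
    exact OnePoint.coe_ne_infty _ h.symm
  obtain ⟨p, hp⟩ := OnePoint.ne_infty_iff_exists.1 hne
  rw [← hp, OnePoint.map_some, OnePoint.coe_eq_coe] at h
  have he := edge_zero_of_initial_eq hp.symm
  rw [firstEdge_cons] at he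
  subst h
  refine ⟨he ▸ p.s_edge_zero, ?_⟩
  rw [← hp, OnePoint.coe_eq_coe]
  conv_lhs => rw [← p.cons_edge_tail]
  congr 1

theorem continuous_cons : Continuous (cons (E := E)) := by
  refine continuous_induced_rng.2 ?_
  rw [isInducing_initial.continuous_iff]
  have hfst : Continuous fun x : {x : D × E.BoundaryPath // E.s x.1 = x.2.range} => x.1.1 :=
    continuous_fst.comp continuous_subtype_val
  have hsnd : ∀ n, Continuous
      fun x : {x : D × E.BoundaryPath // E.s x.1 = x.2.range} => x.1.2.initial n := fun n =>
    (continuous_initial n).comp (continuous_snd.comp continuous_subtype_val)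
  refine continuous_pi fun n => ?_
  cases n with
  | zero =>
    simp only [Function.comp_apply, initial_zero, range_cons]
    exact OnePoint.continuous_coe.comp (Path.continuous_ofVertex.comp (E.continuous_r.comp hfst))
  | succ n =>
    refine continuous_iff_continuousAt.2 fun x => ?_
    -- At `∞` the map `cons` can be tested on tails: if the longer path lay in `K`, its tail would
    -- lie in the compact set of tails of `K`. At finite points it is `Path.cons` on an open
    -- neighbourhood.
    by_cases h : x.1.2.initial n = OnePoint.infty
    · have hx : (cons x).1.initial (n + 1) = OnePoint.infty := by
        by_contra hne
        obtain ⟨p, hp⟩ := OnePoint.ne_infty_iff_exists.1 hne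
        rw [initial_cons, ← hp, OnePoint.map_some] at h
        exact OnePoint.coe_ne_infty _ h
      have h2 := (hsnd n).continuousAt (x := x)
      simp only [ContinuousAt, Function.comp_apply, h, hx, OnePoint.tendsto_infty_iff] at h2 ⊢
      intro K hK
      filter_upwards [h2 _ (hK.image Path.continuous_tail)] with y hy
      rintro ⟨p, hp, hpy⟩
      refine hy ⟨_, ⟨p, hp, rfl⟩, ?_⟩
      rw [initial_cons, ← hpy, OnePoint.map_some]
    · have hO : IsOpen {y : {x : D × E.BoundaryPath // E.s x.1 = x.2.range} |
          y.1.2.initial n ≠ OnePoint.infty} :=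
        OnePoint.isClosed_infty.isOpen_compl.preimage (hsnd n)
      refine ContinuousOn.continuousAt ?_ (hO.mem_nhds h)
      rw [continuousOn_iff_continuous_domRestrict]
      choose q hq using fun y : {y : {x : D × E.BoundaryPath // E.s x.1 = x.2.range} |
          y.1.2.initial n ≠ OnePoint.infty} => OnePoint.ne_infty_iff_exists.1 y.2
      have hqc : Continuous q := by
        rw [OnePoint.isOpenEmbedding_coe.isEmbedding.continuous_iff]
        exact ((hsnd n).comp continuous_subtype_val).congr fun y => (hq y).symm
      choose hs hcons using fun y => initial_cons_of_eq (hq y).symm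
      exact (OnePoint.continuous_coe.comp (Path.continuous_cons
        (hfst.comp continuous_subtype_val) hqc hs)).congr fun y => (hcons y).symm

variable (E) in
/-- A boundary path of positive length is a first edge followed by a boundary path. -/
def homeomorphPullback : ((vertices E)ᶜ : Set E.BoundaryPath) ≃ₜ
    {x : D × E.BoundaryPath // E.s x.1 = x.2.range} where
  toFun β := ⟨(firstEdge β, shift β), s_firstEdge β⟩
  invFun := cons
  left_inv := cons_firstEdge_shift
  right_inv x := Subtype.ext (Prod.ext (firstEdge_cons x) (shift_cons x))
  continuous_toFun := continuous_induced_rng.2 (continuous_firstEdge.prodMk continuous_shift)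
  continuous_invFun := continuous_cons

theorem isLocalHomeomorph_shift : IsLocalHomeomorph (shift (E := E)) :=
  (isLocalHomeomorph_pullback_snd E.isLocalHomeomorph_s continuous_range).comp
    (homeomorphPullback E).isLocalHomeomorph

/-- Given the first edge in `C`, the remaining path has range in the compact set `s(C)`, and the
range map is proper. -/
theorem isCompact_preimage_firstEdge {C : Set D} (hC : IsCompact C) :
    IsCompact (firstEdge (E := E) ⁻¹' C) := by
  have h1 : IsClosedEmbedding
      (Subtype.val : {x : D × E.BoundaryPath // E.s x.1 = x.2.range} → D × E.BoundaryPath) :=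
    IsClosed.isClosedEmbedding_subtypeVal (isClosed_eq (E.continuous_s.comp continuous_fst)
      (continuous_range.comp continuous_snd))
  have h2 := (homeomorphPullback E).isCompact_preimage.2 (h1.isCompact_preimage
    (hC.prod (isCompact_preimage_range (hC.image E.continuous_s))))
  convert h2 using 1
  ext β
  exact ⟨fun h => ⟨h, _, h, s_firstEdge β⟩, fun h => h.1⟩

/-- A fibre of the shift is in bijection with a fibre of the source map. -/
theorem fiberSum_shift_comp_firstEdge {F : Type*} [AddCommMonoid F] (h : D → F)
    (α : E.BoundaryPath) :
    fiberSum shift (fun β => h (firstEdge β)) α = fiberSum E.s h α.range := by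
  refine finsum_eq_of_bijective
    (fun β : shift ⁻¹' {α} => (⟨firstEdge β.1, ?_⟩ : E.s ⁻¹' {α.range})) ⟨?_, ?_⟩ fun β => rfl
  · have : shift β.1 = α := β.2
    exact (s_firstEdge β.1).trans (by rw [this])
  · rintro ⟨β, hβ⟩ ⟨γ, hγ⟩ h
    have he : firstEdge β = firstEdge γ := congrArg Subtype.val h
    have hs : shift β = shift γ := Eq.trans hβ (Eq.symm hγ)
    refine Subtype.ext ((homeomorphPullback E).injective (Subtype.ext (Prod.ext he hs)))
  · rintro ⟨e, he⟩
    exact ⟨⟨cons ⟨(e, α), he⟩, shift_cons _⟩, Subtype.ext (firstEdge_cons _)⟩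

/-- A singular vertex as a boundary path of length zero. -/
def ofSingular (v : E.singular) : E.BoundaryPath := finite 0 (Path.ofVertex v.1) v.2

theorem ofSingular_mem_vertices (v : E.singular) : ofSingular v ∈ vertices E :=
  ⟨Path.ofVertex v.1, v.2, rfl⟩

theorem continuous_ofSingular : Continuous (ofSingular (E := E)) := by
  rw [isInducing_initial.continuous_iff]
  refine continuous_pi fun n => ?_
  cases n with
  | zero =>
    simp only [Function.comp_apply, initial_zero]
    exact OnePoint.continuous_coe.comp (Path.continuous_ofVertex.comp continuous_subtype_val)
  | succ n => exact continuous_const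

end BoundaryPath

end TopologicalGraph

section RadonMeasures

/-! ### Radon measures and compactly supported functions -/

variable {X : Type*} [TopologicalSpace X] [MeasurableSpace X] [BorelSpace X]

/-- A continuous image of a Radon measure need not be outer regular, but inner regularity on open
sets persists. The comparison lemmas below ask no more than this of the pushforwards. -/
theorem innerRegularWRT_map {Y : Type*} [TopologicalSpace Y] [MeasurableSpace Y] [BorelSpace Y]
    {ν : Measure X} [ν.Regular] {π : X → Y} (hπ : Continuous π) :
    (ν.map π).InnerRegularWRT IsCompact IsOpen :=
  (Measure.Regular.innerRegular : ν.InnerRegularWRT IsCompact IsOpen).map hπ.measurable.aemeasurable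
    (fun _ hU => hU.preimage hπ) (fun _ hK => hK.image hπ) (fun _ hU => hU.measurableSet)

theorem lintegral_ofReal_eq {ν : Measure X} [IsFiniteMeasureOnCompacts ν] (f : C_c(X, ℝ))
    (hf : ∀ x, 0 ≤ f x) :
    ∫⁻ x, ENNReal.ofReal (f x) ∂ν = ENNReal.ofReal (∫ x, f x ∂ν) :=
  (ofReal_integral_eq_lintegral_ofReal
    (f.continuous.integrable_of_hasCompactSupport f.hasCompactSupport) (.of_forall hf)).symm

theorem IsRadonPullback.integral_eq_real {Y : Type*} [TopologicalSpace Y] [MeasurableSpace Y]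
    {φ : X → Y} (hφ : IsLocalHomeomorph φ) {μ : Measure Y} {ν : Measure X}
    (h : IsRadonPullback φ μ ν) (f : C_c(X, ℝ)) :
    ∫ x, f x ∂ν = ∫ y, fiberSum φ f y ∂μ := by
  let g : C_c(X, ℂ) := ⟨⟨fun x => (f x : ℂ), by fun_prop⟩,
    f.hasCompactSupport.comp_left (g := fun t : ℝ => (t : ℂ)) (by simp)⟩
  have hg : ∫ x, ((f x : ℝ) : ℂ) ∂ν = ∫ y, fiberSum φ (fun x => ((f x : ℝ) : ℂ)) y ∂μ :=
    h.integral_eq g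
  have hs : ∀ y, fiberSum φ (fun x => ((f x : ℝ) : ℂ)) y = ((fiberSum φ f y : ℝ) : ℂ) :=
    fiberSum_map hφ f.hasCompactSupport Complex.ofRealHom.toAddMonoidHom
  simp only [hs] at hg
  rw [integral_complex_ofReal, integral_complex_ofReal] at hg
  exact_mod_cast hg

/-! ### Limits of averages -/

/-- A sequence of probability measures has a limit functional that is invariant under shifting
the index. -/
theorem exists_limit_of_averages (M : ℕ → Measure X) (hM : ∀ j, IsProbabilityMeasure (M j)) :
    ∃ L : C_c(X, ℝ) →ₚ[ℝ] ℝ,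
      (∀ (f : C_c(X, ℝ)) (c : ℝ), (∀ j, ∫ x, f x ∂(M j) = c) → L f = c) ∧
      ∀ f g : C_c(X, ℝ), (∀ j, ∫ x, f x ∂(M (j + 1)) = ∫ x, g x ∂(M j)) → L f = L g := by
  have hint : ∀ (f : C_c(X, ℝ)) j, Integrable f (M j) := fun f j =>
    f.continuous.integrable_of_hasCompactSupport f.hasCompactSupport
  let a : C_c(X, ℝ) → ℕ → ℝ := fun f j => ∫ x, f x ∂(M j)
  let S : C_c(X, ℝ) → ℕ → ℝ := fun f n => (n + 1 : ℝ)⁻¹ * ∑ j ∈ Finset.range (n + 1), a f j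
  have hbd : ∀ f, ∃ C, 0 ≤ C ∧ ∀ j, |a f j| ≤ C := fun f => by
    obtain ⟨C, hC⟩ := f.hasCompactSupport.exists_bound_of_continuous f.continuous
    refine ⟨max C 0, le_max_right _ _, fun j => ?_⟩
    have := norm_integral_le_of_norm_le_const (μ := M j) (.of_forall hC)
    rw [probReal_univ, mul_one] at this
    exact this.trans (le_max_left _ _)
  have hS : ∀ f, ∃ C, ∀ n, S f n ∈ Set.Icc (-C) C := fun f => by
    obtain ⟨C, hC0, hC⟩ := hbd f
    refine ⟨C, fun n => abs_le.1 ?_⟩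
    have hn : (0 : ℝ) < n + 1 := by positivity
    rw [abs_mul, abs_of_pos (inv_pos.2 hn), inv_mul_le_iff₀ hn]
    refine (Finset.abs_sum_le_sum_abs _ _).trans ((Finset.sum_le_sum fun j _ => hC j).trans ?_)
    simp
  -- The averages of each `f` stay in a compact interval. One ultrafilter serves all `f` at once, so
  -- that the limits depend linearly on `f`.
  have hlim : ∀ f, ∃ l, Filter.Tendsto (S f) (Filter.hyperfilter ℕ) (𝓝 l) := fun f => by
    obtain ⟨C, hC⟩ := hS f
    obtain ⟨l, -, hl⟩ := isCompact_Icc.ultrafilter_le_nhds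
      ((Filter.hyperfilter ℕ).map (S f))
      (Filter.le_principal_iff.2 (Filter.mem_map.2 (Filter.Eventually.of_forall hC)))
    exact ⟨l, hl⟩
  choose l hl using hlim
  have huniq : ∀ {f c}, Filter.Tendsto (S f) (Filter.hyperfilter ℕ) (𝓝 c) → l f = c := fun h =>
    tendsto_nhds_unique (hl _) h
  have hSadd : ∀ f g n, S (f + g) n = S f n + S g n := fun f g n => by
    have : ∀ j, a (f + g) j = a f j + a g j := fun j => integral_add (hint f j) (hint g j)
    simp only [S, this, Finset.sum_add_distrib, mul_add]
  have hSsmul : ∀ (c : ℝ) f n, S (c • f) n = c * S f n := fun c f n => by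
    have : ∀ j, a (c • f) j = c * a f j := fun j => integral_const_mul c f
    simp only [S, this, ← Finset.mul_sum]
    ring
  let L : C_c(X, ℝ) →ₗ[ℝ] ℝ :=
    { toFun := l
      map_add' := fun f g => huniq (((hl f).add (hl g)).congr fun n => (hSadd f g n).symm)
      map_smul' := fun c f => huniq (((hl f).const_mul c).congr fun n => (hSsmul c f n).symm) }
  refine ⟨PositiveLinearMap.mk₀ L fun f hf => ?_, fun f c h => huniq ?_, fun f g h => huniq ?_⟩
  · refine ge_of_tendsto' (hl f) fun n => ?_
    exact mul_nonneg (by positivity) (Finset.sum_nonneg fun j _ => integral_nonneg hf)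
  · refine tendsto_const_nhds.congr fun n => ?_
    have hn : (n + 1 : ℝ) ≠ 0 := by positivity
    have : ∀ j, a f j = c := h
    simp only [S, this, Finset.sum_const, Finset.card_range, nsmul_eq_mul]
    push_cast
    field_simp
  · obtain ⟨C, hC0, hC⟩ := hbd f
    -- The two averages differ only by the end terms of a telescoping sum, which are bounded and
    -- divided by `n + 1`.
    have hdiff : ∀ n, S f n - S g n = (n + 1 : ℝ)⁻¹ * (a f 0 - a f (n + 1)) := fun n => by
      have h' : ∀ j, a g j = a f (j + 1) := fun j => (h j).symm
      simp only [S, h', ← mul_sub, ← Finset.sum_sub_distrib]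
      rw [Finset.sum_range_sub']
    have h0 : Filter.Tendsto (fun n => S f n - S g n) Filter.atTop (𝓝 0) := by
      simp only [hdiff]
      refine Filter.Tendsto.zero_mul_isBoundedUnder_le (tendsto_inv_atTop_zero.comp
        (Filter.tendsto_atTop_add_const_right _ _ tendsto_natCast_atTop_atTop)) ?_
      refine Filter.isBoundedUnder_of ⟨C + C, fun n => ?_⟩
      exact (abs_sub _ _).trans (add_le_add (hC _) (hC _))
    have h1 : Filter.Tendsto (S f) (Filter.hyperfilter ℕ) (𝓝 (l g)) := by
      simpa using (h0.mono_left Nat.hyperfilter_le_atTop).add (hl g)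
    exact h1

/-! ### Comparing measures by means of compactly supported functions -/

variable [T2Space X] [LocallyCompactSpace X]

/-- A Urysohn function between a compact `K ⊆ U` and `U` gives `ν₁ K ≤ ν₂ U`; inner regularity then
lets `K` exhaust `U`. Restricting to supports in `U` allows a comparison on the regular vertices
alone. -/
theorem measure_isOpen_le {ν₁ ν₂ : Measure X} (h₁ : ν₁.InnerRegularWRT IsCompact IsOpen)
    {U : Set X} (hU : IsOpen U)
    (h : ∀ f : C_c(X, ℝ), (∀ x, 0 ≤ f x) → tsupport f ⊆ U →
      ∫⁻ x, ENNReal.ofReal (f x) ∂ν₁ ≤ ∫⁻ x, ENNReal.ofReal (f x) ∂ν₂) : ν₁ U ≤ ν₂ U := by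
  refine le_of_forall_lt fun r hr => ?_
  obtain ⟨K, hKU, hK, hrK⟩ := h₁ hU r hr
  obtain ⟨f, hf1, hf2, hf3, hf4⟩ := exists_continuousMap_one_of_isCompact_subset_isOpen hK hU hKU
  refine hrK.trans_le ?_
  calc ν₁ K = ∫⁻ x in K, 1 ∂ν₁ := by rw [setLIntegral_one]
    _ ≤ ∫⁻ x in K, ENNReal.ofReal (f x) ∂ν₁ := by
      refine setLIntegral_mono' hK.measurableSet fun x hx => ?_
      rw [hf1 hx, Pi.one_apply, ENNReal.ofReal_one]
    _ ≤ ∫⁻ x, ENNReal.ofReal (f x) ∂ν₁ := setLIntegral_le_lintegral _ _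
    _ ≤ ∫⁻ x, ENNReal.ofReal (f x) ∂ν₂ := h ⟨f, hf2⟩ (fun x => (hf4 x).1) hf3
    _ ≤ ∫⁻ x, U.indicator 1 x ∂ν₂ := by
      refine lintegral_mono fun x => ?_
      by_cases hx : x ∈ U
      · rw [Set.indicator_of_mem hx, Pi.one_apply]
        exact ENNReal.ofReal_le_one.2 (hf4 x).2
      · rw [image_eq_zero_of_notMem_tsupport fun h => hx (hf3 h), ENNReal.ofReal_zero]
        exact zero_le
    _ = ν₂ U := lintegral_indicator_one hU.measurableSet

theorem measure_ext_of_lintegral {ν₁ ν₂ : Measure X} [IsFiniteMeasure ν₁]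
    (h₁ : ν₁.InnerRegularWRT IsCompact IsOpen) (h₂ : ν₂.InnerRegularWRT IsCompact IsOpen)
    (h : ∀ f : C_c(X, ℝ), (∀ x, 0 ≤ f x) →
      ∫⁻ x, ENNReal.ofReal (f x) ∂ν₁ = ∫⁻ x, ENNReal.ofReal (f x) ∂ν₂) : ν₁ = ν₂ := by
  have key : ∀ U : Set X, IsOpen U → ν₁ U = ν₂ U := fun U hU =>
    le_antisymm (measure_isOpen_le h₁ hU fun f hf _ => (h f hf).le)
      (measure_isOpen_le h₂ hU fun f hf _ => (h f hf).ge)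
  exact ext_of_generate_finite {U | IsOpen U} BorelSpace.measurable_eq isPiSystem_isOpen
    key (key _ isOpen_univ)

theorem measure_le_of_lintegral_le {ν₁ ν₂ : Measure X} [ν₂.OuterRegular]
    (h₁ : ν₁.InnerRegularWRT IsCompact IsOpen)
    (h : ∀ f : C_c(X, ℝ), (∀ x, 0 ≤ f x) →
      ∫⁻ x, ENNReal.ofReal (f x) ∂ν₁ ≤ ∫⁻ x, ENNReal.ofReal (f x) ∂ν₂) : ν₁ ≤ ν₂ := by
  refine Measure.le_intro fun A _ _ => ?_
  rw [A.measure_eq_iInf_isOpen ν₂]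
  refine le_iInf₂ fun U hAU => le_iInf fun hU => (measure_mono hAU).trans ?_
  exact measure_isOpen_le h₁ hU fun f hf _ => h f hf

/-! ### Lifting measures along proper surjections -/

/-- A Radon measure on the base of a proper surjection lifts to the total space. -/
theorem exists_regular_lift {Y : Type*} [TopologicalSpace Y] [T2Space Y] [LocallyCompactSpace Y]
    [MeasurableSpace Y] [BorelSpace Y] {π : X → Y} (hπ : Continuous π)
    (hp : ∀ K, IsCompact K → IsCompact (π ⁻¹' K)) (hs : Function.Surjective π)
    (μ : Measure Y) [IsFiniteMeasureOnCompacts μ] :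
    ∃ ν : Measure X, ν.Regular ∧ ∀ f : C_c(Y, ℝ), ∫ x, f (π x) ∂ν = ∫ y, f y ∂μ := by
  let T : C_c(Y, ℝ) →ₗ[ℝ] C_c(X, ℝ) :=
    { toFun := fun f => ⟨⟨fun x => f (π x), f.continuous.comp hπ⟩,
        .of_isClosed_subset (hp _ f.hasCompactSupport) isClosed_closure
          (closure_minimal (fun x hx => subset_tsupport f hx)
            ((isClosed_tsupport f).preimage hπ))⟩
      map_add' := fun f g => rfl
      map_smul' := fun c f => rfl }
  have hT : Function.Injective T := fun f g h => by
    ext y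
    obtain ⟨x, rfl⟩ := hs y
    exact DFunLike.congr_fun h x
  have hint : ∀ f : C_c(Y, ℝ), Integrable f μ := fun f =>
    f.continuous.integrable_of_hasCompactSupport f.hasCompactSupport
  let I : C_c(Y, ℝ) →ₗ[ℝ] ℝ :=
    { toFun := fun f => ∫ y, f y ∂μ
      map_add' := fun f g => integral_add (hint f) (hint g)
      map_smul' := fun c f => integral_const_mul c f }
  let e := LinearEquiv.ofInjective T hT
  -- The functional `f ∘ π ↦ ∫ f dμ` is well defined and positive on the functions pulled back from
  -- `Y`, because `π` is surjective. It is extended to a positive functional on all of `C_c(X)`.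
  let F : C_c(X, ℝ) →ₗ.[ℝ] ℝ := ⟨LinearMap.range T, I ∘ₗ e.symm.toLinearMap⟩
  let s : PointedCone ℝ C_c(X, ℝ) :=
    { carrier := {f | ∀ x, 0 ≤ f x}
      add_mem' := fun hf hg x => add_nonneg (hf x) (hg x)
      zero_mem' := fun x => le_rfl
      smul_mem' := fun c f hf x => mul_nonneg c.2 (hf x) }
  obtain ⟨L, hL1, hL2⟩ := riesz_extension s F (fun f hf => by
    obtain ⟨g, rfl⟩ := e.surjective f
    change 0 ≤ I (e.symm (e g))
    rw [LinearEquiv.symm_apply_apply]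
    refine integral_nonneg fun y => ?_
    obtain ⟨x, rfl⟩ := hs y
    exact hf x) (fun f => by
    -- The extension theorem requires every `f` to become nonnegative after adding a pulled-back
    -- function: take `C` times a cutoff equal to `1` on the image of the support of `f`.
    obtain ⟨C, hC⟩ := f.hasCompactSupport.exists_bound_of_continuous f.continuous
    obtain ⟨h, hh1, hh2, -, hh3⟩ := exists_continuousMap_one_of_isCompact_subset_isOpen
      (IsCompact.image f.hasCompactSupport hπ) isOpen_univ (Set.subset_univ _)
    let h' : C_c(Y, ℝ) := ⟨h, hh2⟩
    refine ⟨⟨T (C • h'), _, rfl⟩, fun x => ?_⟩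
    change 0 ≤ C * h (π x) + f x
    by_cases hx : x ∈ tsupport f
    · rw [hh1 ⟨x, hx, rfl⟩, Pi.one_apply, mul_one]
      have := neg_le_of_abs_le (hC x)
      linarith
    · rw [image_eq_zero_of_notMem_tsupport hx, add_zero]
      exact mul_nonneg ((norm_nonneg _).trans (hC x)) (hh3 _).1)
  let P : C_c(X, ℝ) →ₚ[ℝ] ℝ := PositiveLinearMap.mk₀ L fun f hf => hL2 f hf
  refine ⟨RealRMK.rieszMeasure P, inferInstance, fun f => ?_⟩
  refine (RealRMK.integral_rieszMeasure P (T f)).trans ?_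
  change L (T f) = _
  refine (hL1 ⟨T f, f, rfl⟩).trans ?_
  change I (e.symm (e f)) = _
  rw [LinearEquiv.symm_apply_apply]
  rfl

end RadonMeasures

namespace TopologicalGraph

variable {V D : Type*} [TopologicalSpace V] [T2Space V] [LocallyCompactSpace V]
  [TopologicalSpace D] [T2Space D] [LocallyCompactSpace D] {E : TopologicalGraph V D}

/-! ### Compactly supported functions on the boundary path space -/

namespace BoundaryPath

theorem hasCompactSupport_comp_range {F : Type*} [Zero F] [TopologicalSpace F] {f : V → F}
    (hf : HasCompactSupport f) : HasCompactSupport fun α : E.BoundaryPath => f α.range :=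
  (isCompact_preimage_range hf).of_isClosed_subset isClosed_closure
    (closure_minimal (fun _ hx => subset_tsupport f hx)
      ((isClosed_tsupport f).preimage continuous_range))

/-- The extension by zero of a compactly supported function on the boundary paths of positive
length. -/
noncomputable def extendZero {F : Type*} [AddCommGroup F] [TopologicalSpace F]
    (f : C_c(((vertices E)ᶜ : Set E.BoundaryPath), F)) : C_c(E.BoundaryPath, F) :=
  ⟨⟨Function.extend Subtype.val f 0, f.hasCompactSupport.continuous_extend_zero
    isClosed_vertices.isOpen_compl f.continuous⟩,
    f.hasCompactSupport.extend_zero continuous_subtype_val⟩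

theorem extendZero_val {F : Type*} [AddCommGroup F] [TopologicalSpace F]
    (f : C_c(((vertices E)ᶜ : Set E.BoundaryPath), F)) (β : ((vertices E)ᶜ : Set E.BoundaryPath)) :
    extendZero f β.1 = f β := Subtype.val_injective.extend_apply f 0 β

theorem extendZero_of_mem {F : Type*} [AddCommGroup F] [TopologicalSpace F]
    (f : C_c(((vertices E)ᶜ : Set E.BoundaryPath), F)) {α : E.BoundaryPath} (hα : α ∈ vertices E) :
    extendZero f α = 0 :=
  Function.extend_apply' _ _ _ fun ⟨β, hβ⟩ => β.2 (hβ ▸ hα)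

/-- The fibre sums of a compactly supported function along the shift. -/
noncomputable def shiftSum (f : C_c(((vertices E)ᶜ : Set E.BoundaryPath), ℝ)) :
    C_c(E.BoundaryPath, ℝ) :=
  have h := fiberSum_continuous_hasCompactSupport isLocalHomeomorph_shift f.continuous
    f.hasCompactSupport
  ⟨⟨fiberSum shift f, h.1⟩, h.2⟩

variable [MeasurableSpace V] [BorelSpace V] {μ : Measure V}

theorem measurable_range : Measurable (range : E.BoundaryPath → V) :=
  continuous_range.measurable

theorem map_range_eq_of_integral_eq {M : Measure E.BoundaryPath} [M.Regular] [IsFiniteMeasure μ]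
    [μ.Regular] (h : ∀ f : C_c(V, ℝ), ∫ α, f α.range ∂M = ∫ v, f v ∂μ) : M.map range = μ := by
  refine (measure_ext_of_lintegral Measure.Regular.innerRegular
    (innerRegularWRT_map continuous_range) fun f hf => ?_).symm
  let f' : C_c(E.BoundaryPath, ℝ) := ⟨⟨fun α => f α.range, f.continuous.comp continuous_range⟩,
    hasCompactSupport_comp_range f.hasCompactSupport⟩
  have h1 : ∫ α, f' α ∂M = ∫ v, f v ∂μ := h f
  have hfc : Continuous f := f.continuous
  rw [lintegral_map hfc.measurable.ennreal_ofReal measurable_range,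
    lintegral_ofReal_eq f hf, ← h1]
  exact (lintegral_ofReal_eq f' fun α => hf _).symm

end BoundaryPath

variable [MeasurableSpace V] [BorelSpace V] [MeasurableSpace D] [BorelSpace D] {μ : Measure V}

/-! ### Consequences of invariance -/

namespace IsInvariantMeasure

theorem isRadonPullback (hμ : E.IsInvariantMeasure μ) :
    IsRadonPullback E.s μ (radonPullback E.s μ) :=
  have := hμ.isProbabilityMeasure
  isRadonPullback_radonPullback E.isLocalHomeomorph_s μ

theorem lintegral_map_r (ν : Measure D) (f : C_c(V, ℝ)) :
    ∫⁻ v, ENNReal.ofReal (f v) ∂(ν.map E.r) = ∫⁻ e, ENNReal.ofReal (f (E.r e)) ∂ν :=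
  lintegral_map f.continuous.measurable.ennreal_ofReal E.continuous_r.measurable

theorem map_r_le (hμ : E.IsInvariantMeasure μ) : (radonPullback E.s μ).map E.r ≤ μ := by
  have := hμ.isRadonPullback.regular
  have := hμ.regular
  refine measure_le_of_lintegral_le (innerRegularWRT_map E.continuous_r) fun f hf => ?_
  rw [lintegral_map_r]
  exact hμ.lintegral_le f hf

theorem isFiniteMeasure_radonPullback (hμ : E.IsInvariantMeasure μ) :
    IsFiniteMeasure (radonPullback E.s μ) := by
  have := hμ.isProbabilityMeasure
  refine ⟨?_⟩
  have h := hμ.map_r_le Set.univ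
  rw [Measure.map_apply E.continuous_r.measurable .univ, Set.preimage_univ] at h
  exact h.trans_lt (measure_lt_top μ _)

/-- The part of an invariant measure that does not come from the edges is concentrated on the
singular vertices. -/
theorem exists_defect (hμ : E.IsInvariantMeasure μ) :
    ∃ lam : Measure V, lam + (radonPullback E.s μ).map E.r = μ ∧ lam E.regular = 0 := by
  have := hμ.isRadonPullback.regular
  have := hμ.regular
  have := hμ.isProbabilityMeasure
  have := hμ.isFiniteMeasure_radonPullback
  refine ⟨μ - (radonPullback E.s μ).map E.r, Measure.sub_add_cancel_of_le hμ.map_r_le, ?_⟩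
  -- The equality case of invariance applies to functions supported in the open set of regular
  -- vertices, so there the subtracted measure is already as large as `μ`.
  rw [Measure.sub_apply isOpen_regular.measurableSet hμ.map_r_le, tsub_eq_zero_iff_le]
  refine measure_isOpen_le Measure.Regular.innerRegular isOpen_regular fun f hf hfs => ?_
  rw [lintegral_map_r]
  exact (hμ.lintegral_eq f hf hfs).ge

end IsInvariantMeasure

/-! ### Iterating the lift and passing to an invariant limit -/

namespace BoundaryPath

/-- This is base change for pullbacks of measures: fibres of the shift over `α` correspond to fibres
of `s` over the range of `α`, so both sides integrate `h` to `∫ fiberSum E.s h dμ`. Regularity of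
`M` is not required, which matters because the iterates are not shown to be regular. -/
theorem map_firstEdge_radonPullback (hμ : E.IsInvariantMeasure μ) {M : Measure E.BoundaryPath}
    [IsFiniteMeasure M] (hM : M.map range = μ) :
    (radonPullback shift M).map firstEdge = radonPullback E.s μ := by
  have hσ := isRadonPullback_radonPullback (isLocalHomeomorph_shift (E := E)) M
  have := hσ.regular
  have hρ := hμ.isRadonPullback
  have := hρ.regular
  have := hμ.isFiniteMeasure_radonPullback
  refine (measure_ext_of_lintegral Measure.Regular.innerRegular
    (innerRegularWRT_map continuous_firstEdge) fun h hh => ?_).symm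
  let h' : C_c(((vertices E)ᶜ : Set E.BoundaryPath), ℝ) :=
    ⟨⟨fun β => h (firstEdge β), h.continuous.comp continuous_firstEdge⟩,
      (isCompact_preimage_firstEdge h.hasCompactSupport).of_isClosed_subset isClosed_closure
        (closure_minimal (fun _ hx => subset_tsupport h hx)
          ((isClosed_tsupport h).preimage continuous_firstEdge))⟩
  have hc : Continuous h := h.continuous
  have hs := fiberSum_continuous_hasCompactSupport E.isLocalHomeomorph_s hc h.hasCompactSupport
  rw [lintegral_map hc.measurable.ennreal_ofReal continuous_firstEdge.measurable,
    lintegral_ofReal_eq h hh, hρ.integral_eq_real E.isLocalHomeomorph_s]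
  refine Eq.trans ?_ (lintegral_ofReal_eq h' fun β => hh _).symm
  rw [hσ.integral_eq_real isLocalHomeomorph_shift]
  have h1 : ∀ α, fiberSum shift h' α = fiberSum E.s h α.range := fiberSum_shift_comp_firstEdge h
  simp only [h1]
  rw [← integral_map_of_stronglyMeasurable measurable_range hs.1.measurable.stronglyMeasurable, hM]

/-- One step of the construction: from a lift of an invariant measure to the boundary path space,
a new lift is obtained by pulling back along the shift and adding the defect. -/
theorem exists_next (hμ : E.IsInvariantMeasure μ) {M : Measure E.BoundaryPath}
    (hM : M.map range = μ) :
    ∃ M' : Measure E.BoundaryPath, M'.map range = μ ∧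
      ∀ f : C_c(((vertices E)ᶜ : Set E.BoundaryPath), ℝ),
        ∫ α, extendZero f α ∂M' = ∫ α, shiftSum f α ∂M := by
  have := hμ.isProbabilityMeasure
  have hMp : IsFiniteMeasure M := by
    refine ⟨?_⟩
    rw [← Set.preimage_univ (f := range), ← Measure.map_apply measurable_range .univ, hM]
    exact measure_lt_top _ _
  obtain ⟨lam, hlam, hreg⟩ := hμ.exists_defect
  have hsng : MeasurableSet E.singular := isOpen_regular.measurableSet.compl
  have hσ := isRadonPullback_radonPullback (isLocalHomeomorph_shift (E := E)) M
  have hsm : Measurable (ofSingular (E := E)) := continuous_ofSingular.measurable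
  have hvm : Measurable (Subtype.val : ((vertices E)ᶜ : Set E.BoundaryPath) → _) :=
    measurable_subtype_coe
  let M₁ : Measure E.BoundaryPath := (radonPullback shift M).map Subtype.val
  let M₂ : Measure E.BoundaryPath := (lam.comap Subtype.val).map ofSingular
  have h1 : M₁.map range = (radonPullback E.s μ).map E.r := by
    rw [Measure.map_map measurable_range hvm, ← map_firstEdge_radonPullback hμ hM,
      Measure.map_map E.continuous_r.measurable continuous_firstEdge.measurable]
    congr 1
    exact funext fun β => (r_firstEdge β).symm
  have h2 : M₂.map range = lam := by
    rw [Measure.map_map measurable_range hsm]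
    -- The composite of `ofSingular` with the range map is the inclusion of the singular vertices,
    -- so `lam` restricted to them is obtained; nothing is lost, as `lam` vanishes on the regular
    -- vertices.
    refine (MeasurableEmbedding.subtype_coe hsng).map_comap lam |>.trans ?_
    rw [Subtype.range_coe]
    refine Measure.restrict_eq_self_of_ae_mem (compl_mem_ae_iff.2 ?_)
    rw [← hreg]
  have hM' : (M₁ + M₂).map range = μ := by
    rw [Measure.map_add _ _ measurable_range, h1, h2, add_comm, hlam]
  refine ⟨M₁ + M₂, hM', fun f => ?_⟩
  have hfin : IsFiniteMeasure (M₁ + M₂) := by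
    refine ⟨?_⟩
    rw [← Set.preimage_univ (f := range), ← Measure.map_apply measurable_range .univ, hM']
    exact measure_lt_top _ _
  have hfc : Continuous (extendZero f) := (extendZero f).continuous
  have hf := hfc.integrable_of_hasCompactSupport (μ := M₁ + M₂) (extendZero f).hasCompactSupport
  have hfm := hfc.measurable.stronglyMeasurable
  rw [integral_add_measure hf.left_of_add_measure hf.right_of_add_measure,
    integral_map_of_stronglyMeasurable hvm hfm, integral_map_of_stronglyMeasurable hsm hfm]
  -- The defect `M₂` sits on paths of length zero, where the extended function vanishes.
  simp only [extendZero_val, extendZero_of_mem f (ofSingular_mem_vertices _), integral_zero,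
    add_zero]
  exact hσ.integral_eq_real isLocalHomeomorph_shift f

theorem exists_invariant_lift (hμ : E.IsInvariantMeasure μ) :
    ∃ M : Measure E.BoundaryPath, M.Regular ∧ M.map range = μ ∧
      ∀ f : C_c(((vertices E)ᶜ : Set E.BoundaryPath), ℝ),
        ∫ α, extendZero f α ∂M = ∫ α, shiftSum f α ∂M := by
  have := hμ.isProbabilityMeasure
  have := hμ.regular
  obtain ⟨M₀, hM₀, h⟩ := exists_regular_lift (continuous_range (E := E))
    (fun K hK => isCompact_preimage_range hK) surjective_range μ
  choose next hnext1 hnext2 using fun M : {M : Measure E.BoundaryPath // M.map range = μ} =>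
    exists_next hμ M.2
  let M : ℕ → {M : Measure E.BoundaryPath // M.map range = μ} := fun n =>
    (fun M => ⟨next M, hnext1 M⟩)^[n] ⟨M₀, map_range_eq_of_integral_eq h⟩
  have hsucc : ∀ n, (M (n + 1)).1 = next (M n) := fun n =>
    congrArg Subtype.val (Function.iterate_succ_apply' _ n _)
  obtain ⟨L, hL1, hL2⟩ := exists_limit_of_averages (fun n => (M n).1) fun n => by
    refine ⟨?_⟩
    rw [← Set.preimage_univ (f := range), ← Measure.map_apply measurable_range .univ, (M n).2]
    exact measure_univ
  refine ⟨RealRMK.rieszMeasure L, inferInstance, map_range_eq_of_integral_eq fun f => ?_,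
    fun f => ?_⟩
  · let f' : C_c(E.BoundaryPath, ℝ) := ⟨⟨fun α => f α.range, f.continuous.comp continuous_range⟩,
      hasCompactSupport_comp_range f.hasCompactSupport⟩
    -- The integral of `f ∘ range` is the same against every iterate, so the limit of averages keeps
    -- this value.
    refine (RealRMK.integral_rieszMeasure L f').trans (hL1 f' _ fun n => ?_)
    conv_rhs => rw [← (M n).2]
    exact (integral_map_of_stronglyMeasurable measurable_range
      f.continuous.measurable.stronglyMeasurable).symm
  · rw [RealRMK.integral_rieszMeasure, RealRMK.integral_rieszMeasure]
    -- The integral of `extendZero f` against one iterate is that of `shiftSum f` against the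
    -- preceding one, so the index-shift invariance of `L` identifies their limits.
    refine hL2 _ _ fun n => ?_
    rw [hsucc]
    exact hnext2 _ f

end BoundaryPath

end TopologicalGraph

/-! ### The proposition, for complex-valued test functions -/

open TopologicalGraph BoundaryPath in
theorem mainTheorem6 {V D : Type*} [TopologicalSpace V] [T2Space V] [LocallyCompactSpace V]
    [MeasurableSpace V] [BorelSpace V] [TopologicalSpace D] [T2Space D] [LocallyCompactSpace D]
    [MeasurableSpace D] [BorelSpace D] (E : TopologicalGraph V D) (μ : Measure V)
    (hμ : E.IsInvariantMeasure μ) :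
    ∃ μ' : Measure E.BoundaryPath,
      IsProbabilityMeasure μ' ∧ μ'.Regular ∧
      (∀ f : C_c(V, ℂ), ∫ α, f α.range ∂μ' = ∫ v, f v ∂μ) ∧
      IsRadonPullback TopologicalGraph.BoundaryPath.shift μ'
        (radonPullback TopologicalGraph.BoundaryPath.shift μ') ∧
      ∀ f : C_c(((TopologicalGraph.BoundaryPath.vertices E)ᶜ : Set E.BoundaryPath), ℂ),
        ∫ α, f α ∂(radonPullback TopologicalGraph.BoundaryPath.shift μ') =
          ∫ α, Function.extend Subtype.val f 0 α ∂μ' := by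
  have := hμ.isProbabilityMeasure
  obtain ⟨M, hreg, hmap, hM⟩ := exists_invariant_lift hμ
  have hprob : IsProbabilityMeasure M := by
    refine ⟨?_⟩
    rw [← Set.preimage_univ (f := range), ← Measure.map_apply measurable_range .univ, hmap]
    exact measure_univ
  have hpull := isRadonPullback_radonPullback (isLocalHomeomorph_shift (E := E)) M
  refine ⟨M, hprob, hreg, fun f => ?_, hpull, fun f => ?_⟩
  · conv_rhs => rw [← hmap]
    exact (integral_map measurable_range.aemeasurable
      (f.continuous.stronglyMeasurable_of_hasCompactSupport
        f.hasCompactSupport).aestronglyMeasurable).symm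
  · have hR := hpull.regular
    -- For real functions, both integrals equal that of the fibre sum along the shift. The complex
    -- case follows because extension by zero commutes with real and imaginary parts.
    have hreal : ∀ g : C_c(((vertices E)ᶜ : Set E.BoundaryPath), ℝ),
        ∫ α, g α ∂(radonPullback shift M) = ∫ α, extendZero g α ∂M := fun g =>
      (hpull.integral_eq_real isLocalHomeomorph_shift g).trans (hM g).symm
    let fr : C_c(((vertices E)ᶜ : Set E.BoundaryPath), ℝ) := ⟨⟨fun x => (f x).re, by fun_prop⟩,
      f.hasCompactSupport.comp_left (g := Complex.re) (by simp)⟩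
    let fi : C_c(((vertices E)ᶜ : Set E.BoundaryPath), ℝ) := ⟨⟨fun x => (f x).im, by fun_prop⟩,
      f.hasCompactSupport.comp_left (g := Complex.im) (by simp)⟩
    have hr : ∀ α, extendZero fr α = (extendZero f α).re := fun α => by
      by_cases hα : α ∈ vertices E
      · rw [extendZero_of_mem _ hα, extendZero_of_mem _ hα, Complex.zero_re]
      · exact (extendZero_val fr ⟨α, hα⟩).trans
          (congrArg Complex.re (extendZero_val f ⟨α, hα⟩).symm)
    have hi : ∀ α, extendZero fi α = (extendZero f α).im := fun α => by
      by_cases hα : α ∈ vertices E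
      · rw [extendZero_of_mem _ hα, extendZero_of_mem _ hα, Complex.zero_im]
      · exact (extendZero_val fi ⟨α, hα⟩).trans
          (congrArg Complex.im (extendZero_val f ⟨α, hα⟩).symm)
    have k1 := hreal fr
    have k2 := hreal fi
    simp only [hr, hi] at k1 k2
    have i1 : Integrable f (radonPullback shift M) :=
      f.continuous.integrable_of_hasCompactSupport f.hasCompactSupport
    have i2 : Integrable (extendZero f) M :=
      (extendZero f).continuous.integrable_of_hasCompactSupport (extendZero f).hasCompactSupport
    change _ = ∫ α, extendZero f α ∂M
    apply Complex.ext
    · have a := integral_re i1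
      have b := integral_re i2
      simp only [RCLike.re_to_complex] at a b
      rw [← a, ← b]
      exact k1
    · have a := integral_im i1
      have b := integral_im i2
      simp only [RCLike.im_to_complex] at a b
      rw [← a, ← b]
      exact k2
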